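/- Let $R$ be a left coherent ring, let $R\text{-mod}$ be the category of finitely presented left $R$-modules, and let $$\mathbf{D}_{\rm sg}(R)=\mathbf{K}^{-,b}(R\text{-proj})/\mathbf{K}^{b}(R\text{-proj})$$ be the singularity category of $R$, that is, the Verdier quotient of the homotopy category of bounded-above complexes of finitely generated projective left $R$-modules with bounded cohomology by the subcategory of bounded complexes; $\Sigma$ denotes its suspension functor. A module in $R\text{-mod}$ is viewed as an object of $\mathbf{D}_{\rm sg}(R)$ by identifying it with a resolution by finitely generated projective modules. For $M,N\in R\text{-mod}$ write $M^*=\mathrm{Hom}_R(M,R)$, which is a right $R$-module, let $$\phi_{M,N}\colon M^*\otimes_R N\longrightarrow \mathrm{Hom}_R(M,N),\qquad f\otimes y\mapsto (x\mapsto f(x)y),$$ and let $\underline{\mathrm{Hom}}_R(M,N)$ be the quotient of $\mathrm{Hom}_R(M,N)$ by the subgroup of the maps which factor through a finitely generated projective $R$-module. Assume that $M,N\in R\text{-mod}$ and that $\mathrm{Ext}^n_R(M,R)=0$ for all $n\ge 1$. Then there are isomorphisms of abelian groups $$\mathrm{Hom}_{\mathbf{D}_{\rm sg}(R)}(M,\Sigma^n(N))\simeq\begin{cases}\mathrm{Tor}^R_{-(n+1)}(M^*,N),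 & n\le -2,\\ \mathrm{Ker}(\phi_{M,N}), & n=-1,\\ \underline{\mathrm{Hom}}_R(M,N), & n=0,\\ \mathrm{Ext}^n_R(M,N), & n\ge 1.\end{cases}$$ -/

import Mathlib

open CategoryTheory Limits Pretriangulated
open scoped TensorProduct

universe u

/-- A ring is left coherent if each of its finitely generated left ideals is finitely presented. -/
class IsLeftCoherent (R : Type u) [Ring R] : Prop where
  finitePresentation_of_fg (I : Ideal R) (hI : I.FG) : Module.FinitePresentation R I

section HomotopyCategory

open scoped ZeroObject

variable (R : Type u) [Ring R]

/-- Bounded-above cochain complexes of finitely generated projective left `R`-modules. -/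
def boundedAboveProj : ObjectProperty (CochainComplex (ModuleCat.{u} R) ℤ) := fun K =>
  (∃ n : ℤ, K.IsStrictlyLE n) ∧ ∀ i : ℤ, Module.Finite R (K.X i) ∧ Module.Projective R (K.X i)

/-- Bounded cochain complexes of finitely generated projective left `R`-modules. -/
def boundedProj : ObjectProperty (CochainComplex (ModuleCat.{u} R) ℤ) := fun K =>
  (∃ m : ℤ, K.IsStrictlyGE m) ∧ boundedAboveProj R K

/-- The objects of the homotopy category of `R`-modules which have bounded cohomology. -/
def boundedCohomology :
    ObjectProperty (HomotopyCategory (ModuleCat.{u} R) (ComplexShape.up ℤ)) := fun X =>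
  ∃ a b : ℤ, ∀ n : ℤ, (n < a ∨ b < n) →
    IsZero ((HomotopyCategory.homologyFunctor (ModuleCat.{u} R) (ComplexShape.up ℤ) n).obj X)

/-- The objects of the homotopy category of `R`-modules which are bounded-above complexes
of finitely generated projective modules. -/
def kMinusProj : ObjectProperty (HomotopyCategory (ModuleCat.{u} R) (ComplexShape.up ℤ)) :=
  (boundedAboveProj R).strictMap (HomotopyCategory.quotient _ _)

/-- The objects of the homotopy category of `R`-modules which are bounded complexes
of finitely generated projective modules. -/
def kBoundedProj : ObjectProperty (HomotopyCategory (ModuleCat.{u} R) (ComplexShape.up ℤ)) :=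
  (boundedProj R).strictMap (HomotopyCategory.quotient _ _)

/-- The objects of the homotopy category of `R`-modules which are bounded-above complexes
of finitely generated projective modules with bounded cohomology. -/
def kMinusBProj : ObjectProperty (HomotopyCategory (ModuleCat.{u} R) (ComplexShape.up ℤ)) :=
  boundedCohomology R ⊓ kMinusProj R

variable {R}

lemma kMinusProj_quotient_iff (K : CochainComplex (ModuleCat.{u} R) ℤ) :
    kMinusProj R ((HomotopyCategory.quotient _ _).obj K) ↔ boundedAboveProj R K := by
  refine ⟨?_, fun h => ⟨_, h⟩⟩
  simp only [kMinusProj, ObjectProperty.strictMap_iff]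
  rintro ⟨L, h, hL⟩
  obtain rfl : L = K := congr_arg Quotient.as hL
  exact h

lemma kBoundedProj_quotient_iff (K : CochainComplex (ModuleCat.{u} R) ℤ) :
    kBoundedProj R ((HomotopyCategory.quotient _ _).obj K) ↔ boundedProj R K := by
  refine ⟨?_, fun h => ⟨_, h⟩⟩
  simp only [kBoundedProj, ObjectProperty.strictMap_iff]
  rintro ⟨L, h, hL⟩
  obtain rfl : L = K := congr_arg Quotient.as hL
  exact h

lemma boundedAboveProj_shift {K : CochainComplex (ModuleCat.{u} R) ℤ} (n : ℤ)
    (h : boundedAboveProj R K) : boundedAboveProj R (K⟦n⟧) := by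
  obtain ⟨⟨q, _⟩, h⟩ := h
  exact ⟨⟨q - n, K.isStrictlyLE_shift q n (q - n) (by lia)⟩, fun i => h (i + n)⟩

lemma boundedAboveProj_zero : boundedAboveProj R (0 : CochainComplex (ModuleCat.{u} R) ℤ) := by
  refine ⟨⟨0, inferInstance⟩, fun i => ?_⟩
  have h : IsZero ((0 : CochainComplex (ModuleCat.{u} R) ℤ).X i) :=
    (HomologicalComplex.eval (ModuleCat.{u} R) (ComplexShape.up ℤ) i).map_isZero (isZero_zero _)
  have := ModuleCat.isZero_iff_subsingleton.1 h
  exact ⟨inferInstance, inferInstance⟩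

lemma boundedAboveProj_mappingCone {K L : CochainComplex (ModuleCat.{u} R) ℤ} (f : K ⟶ L)
    (hK : boundedAboveProj R K) (hL : boundedAboveProj R L) :
    boundedAboveProj R (CochainComplex.mappingCone f) := by
  obtain ⟨⟨a, _⟩, hK⟩ := hK
  obtain ⟨⟨b, _⟩, hL⟩ := hL
  refine ⟨⟨max a b, ?_⟩, fun i => ?_⟩
  · rw [CochainComplex.isStrictlyLE_iff]
    intro i hi
    simp only [CochainComplex.mappingCone.isZero_X_iff]
    exact ⟨K.isZero_of_isStrictlyLE a _ (by grind), L.isZero_of_isStrictlyLE b _ (by grind)⟩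
  · have e := (HomologicalComplex.homotopyCofiber.XIsoBiprod f i (i + 1) rfl ≪≫
      ModuleCat.biprodIsoProd _ _).toLinearEquiv.symm
    have := (hK (i + 1)).1
    have := (hK (i + 1)).2
    have := (hL i).1
    have := (hL i).2
    exact ⟨Module.Finite.equiv e, Module.Projective.of_equiv e⟩

instance : (kMinusProj R).ContainsZero where
  exists_zero := ⟨(HomotopyCategory.quotient _ _).obj 0, Functor.map_isZero _ (isZero_zero _),
    (kMinusProj_quotient_iff _).2 boundedAboveProj_zero⟩

instance : (kBoundedProj R).ContainsZero where
  exists_zero := ⟨(HomotopyCategory.quotient _ _).obj 0, Functor.map_isZero _ (isZero_zero _),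
    (kBoundedProj_quotient_iff _).2 ⟨⟨0, inferInstance⟩, boundedAboveProj_zero⟩⟩

instance : (kMinusProj R).IsStableUnderShift ℤ where
  isStableUnderShiftBy n :=
    { le_shift K hK := by
        obtain ⟨K : CochainComplex _ _, rfl⟩ := K.quotient_obj_surjective
        rw [kMinusProj_quotient_iff] at hK
        rw [ObjectProperty.prop_shift_iff, HomotopyCategory.shift_quotient_obj,
          kMinusProj_quotient_iff]
        exact boundedAboveProj_shift n hK }

instance : (kBoundedProj R).IsStableUnderShift ℤ where
  isStableUnderShiftBy n :=
    { le_shift K hK := by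
        obtain ⟨K : CochainComplex _ _, rfl⟩ := K.quotient_obj_surjective
        rw [kBoundedProj_quotient_iff] at hK
        rw [ObjectProperty.prop_shift_iff, HomotopyCategory.shift_quotient_obj,
          kBoundedProj_quotient_iff]
        obtain ⟨⟨q, _⟩, hK⟩ := hK
        exact ⟨⟨q - n, K.isStrictlyGE_shift q n (q - n) (by lia)⟩, boundedAboveProj_shift n hK⟩ }

lemma exists_mappingCone_iso
    (T : Triangle (HomotopyCategory (ModuleCat.{u} R) (ComplexShape.up ℤ)))
    (hT : T ∈ distTriang _) :
    ∃ f : T.obj₁.as ⟶ T.obj₂.as,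
      Nonempty (T.obj₃ ≅ (HomotopyCategory.quotient _ _).obj (CochainComplex.mappingCone f)) := by
  obtain ⟨f : T.obj₁.as ⟶ T.obj₂.as, hf⟩ :=
    (HomotopyCategory.quotient _ _).map_surjective T.mor₁
  exact ⟨f, ⟨Triangle.π₃.mapIso (isoTriangleOfIso₁₂ T _ hT
    (HomotopyCategory.mappingCone_triangleh_distinguished f)
    (Iso.refl _) (Iso.refl _)
    ((Category.comp_id _).trans (hf.symm.trans (Category.id_comp _).symm)))⟩⟩

instance : (kMinusProj R).IsTriangulatedClosed₃ where
  ext₃' T hT h₁ h₂ := by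
    obtain ⟨f, ⟨e⟩⟩ := exists_mappingCone_iso T hT
    exact ⟨_, (kMinusProj_quotient_iff _).2 (boundedAboveProj_mappingCone f
      ((kMinusProj_quotient_iff _).1 h₁) ((kMinusProj_quotient_iff _).1 h₂)), ⟨e⟩⟩

instance : (kBoundedProj R).IsTriangulatedClosed₃ where
  ext₃' T hT h₁ h₂ := by
    obtain ⟨f, ⟨e⟩⟩ := exists_mappingCone_iso T hT
    obtain ⟨⟨n₁, _⟩, h₁⟩ := (kBoundedProj_quotient_iff T.obj₁.as).1 h₁
    obtain ⟨⟨n₂, _⟩, h₂⟩ := (kBoundedProj_quotient_iff T.obj₂.as).1 h₂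
    exact ⟨_, (kBoundedProj_quotient_iff _).2 ⟨⟨min (n₁ - 1) n₂,
      CochainComplex.isStrictlyGE_mappingCone f n₁ n₂ _ (by simp) (by simp)⟩,
      boundedAboveProj_mappingCone f h₁ h₂⟩, ⟨e⟩⟩

instance : (kMinusProj R).IsTriangulated where
  toIsTriangulatedClosed₂ := .of_isTriangulatedClosed₃

instance : (kBoundedProj R).IsTriangulated where
  toIsTriangulatedClosed₂ := .of_isTriangulatedClosed₃

instance : (boundedCohomology R).IsClosedUnderIsomorphisms where
  of_iso := by
    rintro X Y e ⟨a, b, h⟩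
    exact ⟨a, b, fun n hn => (h n hn).of_iso
      ((HomotopyCategory.homologyFunctor _ _ n).mapIso e.symm)⟩

instance : (boundedCohomology R).IsTriangulated where
  exists_zero := ⟨(HomotopyCategory.quotient _ _).obj 0, Functor.map_isZero _ (isZero_zero _),
    0, 0, fun n _ => Functor.map_isZero _ (Functor.map_isZero _ (isZero_zero _))⟩
  isStableUnderShiftBy k := ⟨by
    rintro X ⟨a, b, h⟩
    refine ⟨a - k, b - k, fun n hn => ?_⟩
    exact (h (k + n) (by lia)).of_iso
      (((HomotopyCategory.homologyFunctor (ModuleCat.{u} R) (ComplexShape.up ℤ) 0).shiftIso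
        k n (k + n) rfl).app X)⟩
  toIsTriangulatedClosed₂ := .mk' (by
    rintro T hT ⟨a, b, h⟩ ⟨a', b', h'⟩
    refine ⟨min a a', max b b', fun n hn => ?_⟩
    have ex := (HomotopyCategory.homologyFunctor (ModuleCat.{u} R)
      (ComplexShape.up ℤ) n).map_distinguished_exact T hT
    exact ex.isZero_of_both_zeros ((h n (by lia)).eq_of_src _ _)
      ((h' n (by lia)).eq_of_tgt _ _))

instance : (kMinusBProj R).IsTriangulated := by
  dsimp only [kMinusBProj]
  infer_instance

variable (R)

/-- The homotopy category `K^{-,b}(R-proj)` of bounded-above complexes of finitely generated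
projective left `R`-modules with bounded cohomology. -/
abbrev KMinusB := (kMinusBProj R).FullSubcategory

/-- The objects of `K^{-,b}(R-proj)` which are isomorphic to bounded complexes of finitely
generated projective modules, that is, the (strictly full) subcategory `K^b(R-proj)`. -/
def perfectObjects : ObjectProperty (KMinusB R) :=
  (kBoundedProj R).isoClosure.inverseImage (kMinusBProj R).ι

instance : (perfectObjects R).IsTriangulated := by
  dsimp only [perfectObjects]
  infer_instance

/-- The singularity category of `R`: the Verdier quotient `K^{-,b}(R-proj) / K^b(R-proj)`, that is,
the localization of `K^{-,b}(R-proj)` at the morphisms whose cone lies in `K^b(R-proj)`. -/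
abbrev SingularityCategory := (perfectObjects R).trW.Localization

/-- The quotient functor `K^{-,b}(R-proj) ⥤ D_sg(R)`. -/
abbrev SingularityCategory.Q : KMinusB R ⥤ SingularityCategory R := (perfectObjects R).trW.Q

end HomotopyCategory

section Resolutions

variable {R : Type u} [Ring R]

/-- A resolution of the left `R`-module `M` by finitely generated projective modules. -/
structure FGProjectiveResolution (M : ModuleCat.{u} R) extends ProjectiveResolution M where
  finite (n : ℕ) : Module.Finite R (complex.X n)

namespace FGProjectiveResolution

variable {M : ModuleCat.{u} R} (P : FGProjectiveResolution M)

lemma boundedAboveProj_cochainComplex :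
    boundedAboveProj R P.toProjectiveResolution.cochainComplex := by
  refine ⟨⟨0, inferInstance⟩, fun i => ⟨?_, ?_⟩⟩
  · by_cases hi : i ≤ 0
    · obtain ⟨k, rfl⟩ := Int.exists_eq_neg_ofNat hi
      have := P.finite k
      exact Module.Finite.equiv
        (P.toProjectiveResolution.cochainComplexXIso (-k) k).toLinearEquiv.symm
    · have := ModuleCat.isZero_iff_subsingleton.1
        (CochainComplex.isZero_of_isStrictlyLE
          P.toProjectiveResolution.cochainComplex 0 i (by lia))
      infer_instance
  · have h : Projective (P.toProjectiveResolution.cochainComplex.X i) := inferInstance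
    exact (IsProjective.iff_projective _).2 h

lemma boundedCohomology_cochainComplex :
    boundedCohomology R
      ((HomotopyCategory.quotient _ _).obj P.toProjectiveResolution.cochainComplex) := by
  refine ⟨0, 0, fun n hn => ?_⟩
  refine IsZero.of_iso ?_ ((HomotopyCategory.homologyFunctorFactors (ModuleCat.{u} R)
    (ComplexShape.up ℤ) n).app P.toProjectiveResolution.cochainComplex)
  obtain hn | hn := hn
  · exact P.toProjectiveResolution.cochainComplex.isZero_of_isGE 0 n hn
  · exact P.toProjectiveResolution.cochainComplex.isZero_of_isLE 0 n hn

/-- The resolution, as a cochain complex in degrees `≤ 0`, viewed in `K^{-,b}(R-proj)`. -/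
noncomputable def toKMinusB : KMinusB R where
  obj := (HomotopyCategory.quotient _ _).obj P.toProjectiveResolution.cochainComplex
  property := ⟨P.boundedCohomology_cochainComplex,
    (kMinusProj_quotient_iff _).2 P.boundedAboveProj_cochainComplex⟩

/-- The module `M`, identified with its resolution `P`, as an object of `D_sg(R)`. -/
noncomputable def singObj : SingularityCategory R :=
  (SingularityCategory.Q R).obj P.toKMinusB

end FGProjectiveResolution

lemma IsLeftCoherent.finitePresentation_pi [IsLeftCoherent R] :
    ∀ (n : ℕ) (L : Submodule R (Fin n → R)), L.FG → Module.FinitePresentation R L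
  | 0, L, _ => inferInstance
  | n + 1, L, hL => by
    have : Module.Finite R L := Module.Finite.iff_fg.2 hL
    let p : L →ₗ[R] R := (LinearMap.proj 0).comp L.subtype
    have hI : Module.FinitePresentation R (LinearMap.range p) :=
      IsLeftCoherent.finitePresentation_of_fg _
        (Module.Finite.iff_fg.1 (inferInstanceAs (Module.Finite R (LinearMap.range p))))
    have hk : (LinearMap.ker p.rangeRestrict).FG :=
      Module.FinitePresentation.fg_ker _ p.surjective_rangeRestrict
    let t : (LinearMap.ker p.rangeRestrict) →ₗ[R] (Fin n → R) :=
      (LinearMap.funLeft R R Fin.succ).comp (L.subtype.comp (Submodule.subtype _))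
    have ht : Function.Injective t := by
      rw [injective_iff_map_eq_zero]
      rintro ⟨⟨x, hx⟩, hx0⟩ h
      have h0 : x 0 = 0 := by
        simpa [p, LinearMap.rangeRestrict, Subtype.ext_iff] using hx0
      have : x = 0 := by
        funext i
        refine Fin.cases h0 (fun j => ?_) i
        exact congr_fun h j
      subst this
      rfl
    have : Module.Finite R (LinearMap.ker p.rangeRestrict) := Module.Finite.iff_fg.2 hk
    have : Module.FinitePresentation R (LinearMap.range t) :=
      IsLeftCoherent.finitePresentation_pi n _ (by rw [← Module.Finite.iff_fg]; infer_instance)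
    have : Module.FinitePresentation R (LinearMap.ker p.rangeRestrict) :=
      Module.FinitePresentation.of_equiv (R := R) (M := LinearMap.range t)
        (N := LinearMap.ker p.rangeRestrict) (LinearEquiv.ofInjective t ht).symm
    exact Module.finitePresentation_of_ker p.rangeRestrict p.surjective_rangeRestrict

lemma IsLeftCoherent.finite_ker [IsLeftCoherent R] {P Q : Type u} [AddCommGroup P] [Module R P]
    [AddCommGroup Q] [Module R Q] [Module.Finite R P] [Module.Finite R Q] [Module.Projective R Q]
    (f : P →ₗ[R] Q) : Module.Finite R (LinearMap.ker f) := by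
  obtain ⟨n, π, hπ⟩ := Module.Finite.exists_fin' R Q
  obtain ⟨s, hs⟩ := Module.projective_lifting_property π LinearMap.id hπ
  have hsi : Function.Injective s := Function.LeftInverse.injective (LinearMap.congr_fun hs)
  have hr : Module.FinitePresentation R (LinearMap.range (s.comp f)) :=
    IsLeftCoherent.finitePresentation_pi n _ (by rw [← Module.Finite.iff_fg]; infer_instance)
  have := Module.FinitePresentation.fg_ker (s.comp f).rangeRestrict
    (LinearMap.surjective_rangeRestrict _)
  rw [LinearMap.ker_rangeRestrict, LinearMap.ker_comp, LinearMap.ker_eq_bot.2 hsi,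
    Submodule.comap_bot] at this
  exact Module.Finite.iff_fg.2 this

lemma exists_finite_cover (Z : ModuleCat.{u} R) : ∃ (F : ModuleCat.{u} R) (π : F ⟶ Z),
    Projective F ∧ Epi π ∧ (Module.Finite R Z → Module.Finite R F) := by
  by_cases hZ : Module.Finite R Z
  · obtain ⟨n, π, hπ⟩ := Module.Finite.exists_fin' R Z
    exact ⟨ModuleCat.of R (Fin n → R), ModuleCat.ofHom π,
      (IsProjective.iff_projective (Fin n → R)).1 inferInstance, (ModuleCat.epi_iff_surjective _).2 hπ,
      fun _ => inferInstanceAs (Module.Finite R (Fin n → R))⟩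
  · exact ⟨Projective.over Z, Projective.π Z, inferInstance, inferInstance, fun h => (hZ h).elim⟩

lemma exists_finite_chainComplex [IsLeftCoherent R] (M : ModuleCat.{u} R)
    [Module.FinitePresentation R M] :
    ∃ (C : ChainComplex (ModuleCat.{u} R) ℕ) (p : C.X 0 ⟶ M) (w : C.d 1 0 ≫ p = 0),
      (∀ n, Projective (C.X n)) ∧ (∀ n, Module.Finite R (C.X n)) ∧
      (∀ n, C.ExactAt (n + 1)) ∧ (ShortComplex.mk (C.d 1 0) p w).Exact ∧ Epi p := by
  choose F π hF hπ hfin using exists_finite_cover (R := R)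
  let C : ChainComplex (ModuleCat.{u} R) ℕ := ChainComplex.mk' (F M) (F (kernel (π M)))
    (π _ ≫ kernel.ι _) (fun f => ⟨F (kernel f), π _ ≫ kernel.ι f, by simp⟩)
  let p : C.X 0 ⟶ M := π M
  have hp : Epi p := hπ M
  let e₁ : C.X 1 ≅ F (kernel p) := Iso.refl _
  have hd0 : C.d 1 0 = e₁.hom ≫ π (kernel p) ≫ kernel.ι p :=
    (ChainComplex.mk'_d_1_0 ..).trans (Category.id_comp _).symm
  let e (n : ℕ) : C.X (n + 2) ≅ F (kernel (C.d (n + 1) n)) := ChainComplex.mk'XIso ..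
  have hd (n : ℕ) : C.d (n + 2) (n + 1) = (e n).hom ≫ π _ ≫ kernel.ι (C.d (n + 1) n) :=
    ChainComplex.mk'_d ..
  have hX0 : Module.Finite R (C.X 0) := hfin M inferInstance
  have hproj0 : Projective (C.X 0) := hF M
  clear_value e e₁ p C
  have hproj (n : ℕ) : Projective (C.X n) := by
    obtain (_ | _ | n) := n
    · exact hproj0
    · exact Projective.of_iso e₁.symm (hF _)
    · exact Projective.of_iso (e n).symm (hF _)
  have w : C.d 1 0 ≫ p = 0 := by simp [hd0]
  have ex0 : (ShortComplex.mk (C.d 1 0) p w).Exact := by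
    rw [ShortComplex.exact_iff_epi_kernel_lift]
    have h2 : kernel.lift p (C.d 1 0) w = e₁.hom ≫ π (kernel p) := by
      rw [← cancel_mono (kernel.ι _), kernel.lift_ι, hd0, Category.assoc]
    have h3 : Epi (kernel.lift p (C.d 1 0) w) := by
      rw [h2]
      infer_instance
    exact h3
  have ex (n : ℕ) : C.ExactAt (n + 1) := by
    rw [HomologicalComplex.exactAt_iff' _ (n + 2) (n + 1) n (by simp) (by simp),
      ShortComplex.exact_iff_epi_kernel_lift]
    have h2 : kernel.lift (C.d (n + 1) n) (C.d (n + 2) (n + 1)) (C.d_comp_d _ _ _) =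
        (e n).hom ≫ π _ := by
      rw [← cancel_mono (kernel.ι _), kernel.lift_ι]
      simp [hd]
    have h3 : Epi (kernel.lift (C.d (n + 1) n) (C.d (n + 2) (n + 1)) (C.d_comp_d _ _ _)) := by
      rw [h2]
      infer_instance
    exact h3
  have hX1 : Module.Finite R (C.X 1) := by
    have := Module.FinitePresentation.fg_ker p.hom ((ModuleCat.epi_iff_surjective _).1 hp)
    have : Module.Finite R (LinearMap.ker p.hom) := Module.Finite.iff_fg.2 this
    have := hfin _ (Module.Finite.equiv (ModuleCat.kernelIsoKer p).toLinearEquiv.symm)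
    exact Module.Finite.equiv e₁.toLinearEquiv.symm
  have hXfin (n : ℕ) : Module.Finite R (C.X n) ∧ Module.Finite R (C.X (n + 1)) := by
    induction n with
    | zero => exact ⟨hX0, hX1⟩
    | succ n ih =>
      refine ⟨ih.2, ?_⟩
      have := ih.1
      have := ih.2
      have : Module.Projective R (C.X n) := (IsProjective.iff_projective _).2 (hproj n)
      have := IsLeftCoherent.finite_ker (C.d (n + 1) n).hom
      have := hfin _ (Module.Finite.equiv
        (ModuleCat.kernelIsoKer (C.d (n + 1) n)).toLinearEquiv.symm)
      exact Module.Finite.equiv (e n).toLinearEquiv.symm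
  exact ⟨C, p, w, hproj, fun n => (hXfin n).1, ex, ex0, hp⟩

/-- Over a left coherent ring, every finitely presented module has a resolution by finitely
generated projective modules. -/
theorem FGProjectiveResolution.nonempty [IsLeftCoherent R] (M : ModuleCat.{u} R)
    [Module.FinitePresentation R M] : Nonempty (FGProjectiveResolution M) := by
  obtain ⟨C, p, w, hproj, hfin, ex, ex0, hp⟩ := exists_finite_chainComplex M
  refine ⟨{
    complex := C
    projective := hproj
    π := (ChainComplex.toSingle₀Equiv _ _).symm ⟨p, w⟩
    quasiIso := ⟨fun n => ?_⟩
    finite := hfin }⟩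
  cases n
  · rw [ChainComplex.quasiIsoAt₀_iff, ShortComplex.quasiIso_iff_of_zeros']
    · refine (ShortComplex.exact_and_epi_g_iff_of_iso ?_).2 ⟨ex0, hp⟩
      exact ShortComplex.isoMk (Iso.refl _) (Iso.refl _) (Iso.refl _)
        ((Category.id_comp _).trans (Category.comp_id _).symm)
        ((Category.id_comp _).trans ((ChainComplex.toSingle₀Equiv_symm_apply_f_zero p w).symm.trans
          (Category.comp_id _).symm))
    all_goals first | rfl | exact C.shape _ _ (by simp)
  · rw [quasiIsoAt_iff_exactAt']
    · apply ex
    · apply ChainComplex.exactAt_succ_single_obj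

/-- The full subcategory `⊥R` of the finitely presented modules `M` with `Ext^n_R(M, R) = 0` for
all `n ≥ 1`. -/
def leftPerp (R : Type u) [Ring R] : ObjectProperty (ModuleCat.{u} R) := fun M =>
  Module.FinitePresentation R M ∧
    ∀ n : ℕ, 1 ≤ n → Subsingleton (Abelian.Ext M (ModuleCat.of R R) n)

end Resolutions

section Tensor

variable (R : Type u) [Ring R]

/-- The relations `(a r) ⊗ x = a ⊗ (r x)` in `A ⊗_ℤ N`, for a right `R`-module `A` and a left
`R`-module `N`. -/
def balancedRelations (A : Type u) [AddCommGroup A] [Module Rᵐᵒᵖ A]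
    (N : Type u) [AddCommGroup N] [Module R N] : AddSubgroup (A ⊗[ℤ] N) :=
  AddSubgroup.closure {z | ∃ (a : A) (r : R) (x : N),
    z = (MulOpposite.op r • a) ⊗ₜ[ℤ] x - a ⊗ₜ[ℤ] (r • x)}

/-- The tensor product `A ⊗_R N` of a right `R`-module `A` and a left `R`-module `N` over the
(possibly noncommutative) ring `R`. -/
abbrev BalancedTensor (A : Type u) [AddCommGroup A] [Module Rᵐᵒᵖ A]
    (N : Type u) [AddCommGroup N] [Module R N] : Type u :=
  (A ⊗[ℤ] N) ⧸ balancedRelations R A N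

namespace BalancedTensor

variable (A : Type u) [AddCommGroup A] [Module Rᵐᵒᵖ A]
variable {N N' : Type u} [AddCommGroup N] [Module R N] [AddCommGroup N'] [Module R N']

/-- The map `A ⊗_R f : A ⊗_R N → A ⊗_R N'`. -/
def map (f : N →ₗ[R] N') : BalancedTensor R A N →+ BalancedTensor R A N' :=
  QuotientAddGroup.map _ _ (TensorProduct.map (LinearMap.id (R := ℤ) (M := A))
      f.toAddMonoidHom.toIntLinearMap).toAddMonoidHom (by
    rw [balancedRelations, AddSubgroup.closure_le]
    rintro _ ⟨a, r, x, rfl⟩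
    refine AddSubgroup.subset_closure ⟨a, r, f x, ?_⟩
    simp)

@[simp]
lemma map_mk_tmul (f : N →ₗ[R] N') (a : A) (x : N) :
    map R A f (QuotientAddGroup.mk (a ⊗ₜ[ℤ] x)) = QuotientAddGroup.mk (a ⊗ₜ[ℤ] f x) := rfl

variable {R A} in
lemma hom_ext {B : Type*} [AddCommGroup B] {f g : BalancedTensor R A N →+ B}
    (h : ∀ (a : A) (x : N),
      f (QuotientAddGroup.mk (a ⊗ₜ[ℤ] x)) = g (QuotientAddGroup.mk (a ⊗ₜ[ℤ] x))) : f = g := by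
  refine QuotientAddGroup.addMonoidHom_ext _ (AddMonoidHom.ext fun z => ?_)
  · induction z using TensorProduct.induction_on with
    | zero => simp
    | tmul a x => exact h a x
    | add z z' hz hz' => rw [map_add, map_add, hz, hz']

end BalancedTensor

/-- The functor `A ⊗_R -` from left `R`-modules to abelian groups, for a right `R`-module `A`. -/
def tensorFunctor (A : Type u) [AddCommGroup A] [Module Rᵐᵒᵖ A] :
    ModuleCat.{u} R ⥤ AddCommGrpCat.{u} where
  obj N := AddCommGrpCat.of (BalancedTensor R A N)
  map f := AddCommGrpCat.ofHom (BalancedTensor.map R A f.hom)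
  map_id N := by
    ext1
    exact BalancedTensor.hom_ext fun a x => rfl
  map_comp f g := by
    ext1
    exact BalancedTensor.hom_ext fun a x => rfl

instance (A : Type u) [AddCommGroup A] [Module Rᵐᵒᵖ A] : (tensorFunctor R A).Additive where
  map_add {X Y f g} := by
    ext1
    refine BalancedTensor.hom_ext fun a x => ?_
    change QuotientAddGroup.mk (a ⊗ₜ[ℤ] (f.hom x + g.hom x)) =
      QuotientAddGroup.mk (a ⊗ₜ[ℤ] f.hom x) + QuotientAddGroup.mk (a ⊗ₜ[ℤ] g.hom x)
    rw [TensorProduct.tmul_add, QuotientAddGroup.mk_add]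

/-- The group `Tor_i^R(A, N)` for a right `R`-module `A` and a left `R`-module `N`: the `i`-th left
derived functor of `A ⊗_R -`, evaluated at `N`. -/
noncomputable def TorGroup (A : Type u) [AddCommGroup A] [Module Rᵐᵒᵖ A] (N : ModuleCat.{u} R)
    (i : ℕ) : AddCommGrpCat.{u} :=
  ((tensorFunctor R A).leftDerived i).obj N

variable (M N : Type u) [AddCommGroup M] [Module R M] [AddCommGroup N] [Module R N]

/-- The canonical map `φ_{M,N} : M* ⊗_R N → Hom_R(M, N)` which sends `f ⊗ y` to the
map `x ↦ f(x) y`. The dual `M* = Hom_R(M, R)` is a right `R`-module by `(f r)(x) = f(x) r`. -/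
def canonicalMap : BalancedTensor R (M →ₗ[R] R) N →+ (M →ₗ[R] N) :=
  QuotientAddGroup.lift _ (TensorProduct.liftAddHom
      { toFun := fun f =>
          { toFun := fun y => f.smulRight y
            map_zero' := by ext x; simp
            map_add' := fun y y' => by ext x; simp }
        map_zero' := by ext y x; simp
        map_add' := fun f f' => by ext y x; simp [add_smul] }
      (fun n f y => by ext x; simp [mul_smul, Int.cast_smul_eq_zsmul, smul_comm n (f x) y])) (by
    rw [balancedRelations, AddSubgroup.closure_le]
    rintro _ ⟨f, r, y, rfl⟩
    ext x
    simp [mul_smul])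

lemma canonicalMap_tmul (f : M →ₗ[R] R) (y : N) (x : M) :
    canonicalMap R M N (QuotientAddGroup.mk (f ⊗ₜ[ℤ] y)) x = f x • y := rfl

/-- The maps `M → N` which factor through a finitely generated projective module. -/
def factorsThroughProj : AddSubgroup (M →ₗ[R] N) where
  carrier := {f | ∃ (P : Type u) (_ : AddCommGroup P) (_ : Module R P),
    Module.Finite R P ∧ Module.Projective R P ∧ ∃ (g : M →ₗ[R] P) (h : P →ₗ[R] N), h ∘ₗ g = f}
  zero_mem' := ⟨R, inferInstance, inferInstance, inferInstance, inferInstance, 0, 0, by simp⟩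
  add_mem' := by
    rintro _ _ ⟨P, _, _, _, _, g, h, rfl⟩ ⟨P', _, _, _, _, g', h', rfl⟩
    exact ⟨P × P', inferInstance, inferInstance, inferInstance, inferInstance,
      g.prod g', h.coprod h', by ext x; simp⟩
  neg_mem' := by
    rintro _ ⟨P, _, _, h₁, h₂, g, h, rfl⟩
    exact ⟨P, inferInstance, inferInstance, h₁, h₂, g, -h, by ext x; simp⟩

/-- The group of morphisms from `M` to `N` in the stable category of finitely presented modules
modulo projective modules. -/
abbrev StableHom : Type u := (M →ₗ[R] N) ⧸ factorsThroughProj R M N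

end Tensor

/-! ### Morphisms from a resolution to bounded complexes of projectives -/

section

open scoped ZeroObject

variable {R : Type u} [Ring R]

/-! View the resolutions `P` of `M` and `Q` of `N` as complexes in degrees `≤ 0`. A morphism `P ⟶ Y`
in the Verdier quotient is a fraction whose denominator has a perfect cone. Since `Ext^n(M, R) = 0`
for `n ≥ 1`, there are no nonzero maps in the homotopy category from `P` to a finitely generated
projective placed in negative degree. So the negative terms of a perfect complex can be stripped off
one at a time, and every map from `P` to it factors through one in degrees `≥ 0`
(`exists_factor_isStrictlyGE_zero`). Denominators may then be taken with such a cone.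

Consequently (`Q_map_surjective`, `Q_map_eq_zero_iff`, `Q_map_bijective`) the quotient functor is
bijective on maps from `P` to `Q⟦n⟧` for `n ≥ 1`, where the homotopy category computes `Ext`. For `n
= 0` it is still surjective, and its kernel consists of the maps through a perfect complex in
degrees `≥ 0`; only the degree `0` term of that complex matters, so these are the maps `M ⟶ N` that
factor through a projective.

For `n < 0`, finitely generated projectives vanish in the quotient, so `N` is the suspension of its
syzygy, and the group in degree `-(k + 1)` is the group of stable maps from `M` to the `(k + 1)`-st
syzygy of `N`. It remains to compare stable maps with tensor products: `φ_{M,F}` is bijective for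
`F` finitely generated projective, so `M* ⊗ Q` can be replaced by `Hom(M, Q)`, and both `Ker
φ_{M,N}` and `Tor` become stable maps into syzygies (`nonempty_stableHom_addEquiv_ker`,
`nonempty_homology_addEquiv_stableHom`). Coherence keeps the syzygies finitely presented. -/

lemma quotient_hom_eq_zero_of_isStrictlyGE_of_isStrictlyLE
    {K L : CochainComplex (ModuleCat.{u} R) ℤ} (a b : ℤ) (h : b < a)
    [K.IsStrictlyGE a] [L.IsStrictlyLE b]
    (f : (HomotopyCategory.quotient _ (ComplexShape.up ℤ)).obj K ⟶
      (HomotopyCategory.quotient _ (ComplexShape.up ℤ)).obj L) : f = 0 := by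
  obtain ⟨f, rfl⟩ := (HomotopyCategory.quotient _ _).map_surjective f
  have : f = 0 := by
    ext1 i
    by_cases hi : i < a
    · exact (K.isZero_of_isStrictlyGE a i hi).eq_of_src _ _
    · exact (L.isZero_of_isStrictlyLE b i (by lia)).eq_of_tgt _ _
  rw [this, Functor.map_zero]

/-- Removing the lowest term of a bounded complex of projective modules. -/
lemma exists_subcomplex_isStrictlyGE_succ (C : CochainComplex (ModuleCat.{u} R) ℤ)
    (hC : boundedProj R C) (m : ℤ) [C.IsStrictlyGE m] :
    ∃ (C' : CochainComplex (ModuleCat.{u} R) ℤ) (i : C' ⟶ C)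
      (p : C ⟶ (HomologicalComplex.single (ModuleCat.{u} R) (ComplexShape.up ℤ) m).obj (C.X m)),
      boundedProj R C' ∧ C'.IsStrictlyGE (m + 1) ∧
      ∀ (X : HomotopyCategory (ModuleCat.{u} R) (ComplexShape.up ℤ))
        (f : X ⟶ (HomotopyCategory.quotient _ _).obj C),
        f ≫ (HomotopyCategory.quotient _ _).map p = 0 →
        ∃ g, f = g ≫ (HomotopyCategory.quotient _ _).map i := by
  -- Projection to the lowest term is a chain map because nothing nonzero maps into degree `m`.
  let p : C ⟶ (HomologicalComplex.single (ModuleCat.{u} R) (ComplexShape.up ℤ) m).obj (C.X m) :=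
    HomologicalComplex.mkHomToSingle (𝟙 _)
      (fun j hj => (C.isZero_of_isStrictlyGE m j (by simp at hj; lia)).eq_of_src _ _)
  have hpm : IsIso (p.f m) := by
    have : p.f m = (HomologicalComplex.singleObjXSelf (ComplexShape.up ℤ) m (C.X m)).inv := by
      simp [p]
    rw [this]
    infer_instance
  have hz (j : ℤ) (hj : j ≠ m) :
      IsZero (((HomologicalComplex.single (ModuleCat.{u} R) (ComplexShape.up ℤ) m).obj
        (C.X m)).X j) :=
    HomologicalComplex.isZero_single_obj_X _ _ _ _ hj
  have hepi (j : ℤ) : Epi (p.f j) := by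
    by_cases hj : j = m
    · subst hj; infer_instance
    · exact (hz j hj).epi _
  have : Epi p := HomologicalComplex.epi_of_epi_f _ hepi
  let S : ShortComplex (CochainComplex (ModuleCat.{u} R) ℤ) :=
    ShortComplex.mk (kernel.ι p) p (kernel.condition p)
  have hS : S.ShortExact := { exact := ShortComplex.exact_kernel p }
  have hSn (n : ℤ) : (S.map (HomologicalComplex.eval _ _ n)).ShortExact :=
    hS.map_of_exact _
  have hproj (n : ℤ) : Projective (S.map (HomologicalComplex.eval _ _ n)).X₃ := by
    by_cases hn : n = m
    · have : Projective (C.X m) := (IsProjective.iff_projective _).1 (hC.2.2 m).2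
      rw [hn]
      exact Projective.of_iso (@asIso _ _ _ _ (p.f m) hpm) this
    · exact (hz n hn).projective
  let σ (n : ℤ) := (hSn n).splittingOfProjective
  -- The quotient is degreewise projective, so the sequence splits degreewise and gives a
  -- distinguished triangle; the factorization is then exactness of `Hom(X, -)`.
  have hT := (HomotopyCategory.distinguished_iff_iso_trianglehOfDegreewiseSplit
    (CochainComplex.trianglehOfDegreewiseSplit S σ)).2 ⟨S, σ, ⟨Iso.refl _⟩⟩
  have hr (n : ℤ) : ((σ n).r.hom : C.X n →ₗ[R] (kernel p).X n).comp
      ((kernel.ι p).f n).hom = LinearMap.id := by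
    have := (σ n).f_r
    exact congr_arg ModuleCat.Hom.hom this
  have hGE : (kernel p).IsStrictlyGE (m + 1) := by
    rw [CochainComplex.isStrictlyGE_iff]
    intro j hj
    have : Mono ((kernel.ι p).f j) := (hSn j).mono_f
    by_cases hj' : j = m
    · subst hj'
      have h0 : (kernel.ι p).f j = 0 := by
        rw [← cancel_mono (p.f j), zero_comp, ← HomologicalComplex.comp_f, kernel.condition]
        rfl
      exact IsZero.of_mono_eq_zero _ h0
    · exact IsZero.of_mono ((kernel.ι p).f j) (C.isZero_of_isStrictlyGE m j (by lia))
  refine ⟨kernel p, kernel.ι p, p, ⟨⟨m + 1, hGE⟩, ?_, fun n => ?_⟩, hGE, fun X f hf => ?_⟩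
  · obtain ⟨b, hb⟩ := hC.2.1
    refine ⟨b, ?_⟩
    rw [CochainComplex.isStrictlyLE_iff]
    intro j hj
    have : Mono ((kernel.ι p).f j) := (hSn j).mono_f
    exact IsZero.of_mono ((kernel.ι p).f j) (C.isZero_of_isStrictlyLE b j hj)
  · have : Module.Finite R ((S.map (HomologicalComplex.eval _ _ n)).X₂) := (hC.2.2 n).1
    have : Module.Projective R ((S.map (HomologicalComplex.eval _ _ n)).X₂) := (hC.2.2 n).2
    exact ⟨Module.Finite.of_surjective ((σ n).r.hom : C.X n →ₗ[R] (kernel p).X n)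
        (fun x => ⟨_, LinearMap.congr_fun (hr n) x⟩),
      Module.Projective.of_split _ _ (hr n)⟩
  · exact Triangle.coyoneda_exact₂ _ hT f hf

/-- `F` is a retract of some `R^k`, so its identity is a sum of endomorphisms factoring through `R`,
each of which kills every class. -/
lemma subsingleton_ext_of_leftPerp {M : ModuleCat.{u} R} (hM : leftPerp R M)
    (F : ModuleCat.{u} R) [Module.Finite R F] [Module.Projective R F] (n : ℕ) (hn : 1 ≤ n) :
    Subsingleton (Abelian.Ext M F n) := by
  have := hM.2 n hn
  obtain ⟨k, π, hπ⟩ := Module.Finite.exists_fin' R F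
  obtain ⟨s, hs⟩ := Module.projective_lifting_property π LinearMap.id hπ
  let a (i : Fin k) : F ⟶ ModuleCat.of R R := ModuleCat.ofHom ((LinearMap.proj i).comp s)
  let b (i : Fin k) : ModuleCat.of R R ⟶ F :=
    ModuleCat.ofHom (π.comp (LinearMap.single R (fun _ => R) i))
  have hab : 𝟙 F = ∑ i, a i ≫ b i := by
    ext x
    have h1 : π (s x) = x := LinearMap.congr_fun hs x
    conv_lhs => rw [ModuleCat.id_apply, ← h1, ← Finset.univ_sum_single (s x), map_sum]
    simp [ModuleCat.hom_sum, a, b]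
  refine subsingleton_of_forall_eq 0 fun α => ?_
  have h (i : Fin k) : α.comp (Abelian.Ext.mk₀ (a i ≫ b i)) (add_zero n) = 0 := by
    rw [← Abelian.Ext.mk₀_comp_mk₀,
      ← Abelian.Ext.comp_assoc _ _ _ (add_zero n) (add_zero 0) (by simp),
      Subsingleton.elim (α.comp (Abelian.Ext.mk₀ (a i)) (add_zero n)) 0, Abelian.Ext.zero_comp]
  rw [← α.comp_mk₀_id, hab, Abelian.Ext.mk₀_sum, Abelian.Ext.comp_sum]
  exact Finset.sum_eq_zero fun i _ => h i

/-- With `m = -n`, these morphisms form `Ext^n(M, F)` and `n ≥ 1`. This is the only place where the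
vanishing of `Ext(M, R)` enters. -/
lemma quotient_hom_single_eq_zero {M : ModuleCat.{u} R} (hM : leftPerp R M)
    (P : ProjectiveResolution M)
    (F : ModuleCat.{u} R) [Module.Finite R F] [Module.Projective R F] (m : ℤ) (hm : m < 0)
    (f : (HomotopyCategory.quotient _ (ComplexShape.up ℤ)).obj P.cochainComplex ⟶
      (HomotopyCategory.quotient _ (ComplexShape.up ℤ)).obj
        ((HomologicalComplex.single (ModuleCat.{u} R) (ComplexShape.up ℤ) m).obj F)) : f = 0 := by
  obtain ⟨n, rfl⟩ : ∃ n : ℕ, m = -n := ⟨(-m).toNat, by lia⟩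
  let e : ((CochainComplex.singleFunctor (ModuleCat.{u} R) 0).obj F)⟦(n : ℤ)⟧ ≅
      (HomologicalComplex.single (ModuleCat.{u} R) (ComplexShape.up ℤ) (-n)).obj F :=
    ((CochainComplex.singleFunctors (ModuleCat.{u} R)).shiftIso (n : ℤ) (-n) 0
    (by lia)).app F
  have := subsingleton_ext_of_leftPerp hM F n (by lia)
  have := (P.extAddEquivCohomologyClass (Y := F) (n := n)).symm.toEquiv.subsingleton
  have h2 := (CochainComplex.HomComplex.CohomologyClass.homAddEquiv
    (K := P.cochainComplex) (L := (CochainComplex.singleFunctor _ 0).obj F)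
    (n := (n : ℤ))).symm.toEquiv.subsingleton
  rw [← cancel_mono ((HomotopyCategory.quotient _ _).map e.inv)]
  exact Subsingleton.elim (α := (HomotopyCategory.quotient _ _).obj P.cochainComplex ⟶
    (HomotopyCategory.quotient _ _).obj (((CochainComplex.singleFunctor _ 0).obj F)⟦(n : ℤ)⟧)) _ _

/-- A morphism from a resolution of a module in `⊥R` to a bounded complex of finitely generated
projective modules factors through such a complex which is concentrated in degrees `≥ 0`. -/
lemma exists_factor_isStrictlyGE_zero {M : ModuleCat.{u} R} (hM : leftPerp R M)
    (P : ProjectiveResolution M) (n : ℕ) :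
    ∀ (C : CochainComplex (ModuleCat.{u} R) ℤ) (_ : boundedProj R C) (_ : C.IsStrictlyGE (-n))
      (f : (HomotopyCategory.quotient _ (ComplexShape.up ℤ)).obj P.cochainComplex ⟶
        (HomotopyCategory.quotient _ (ComplexShape.up ℤ)).obj C),
      ∃ (C' : CochainComplex (ModuleCat.{u} R) ℤ) (i : C' ⟶ C)
        (g : (HomotopyCategory.quotient _ (ComplexShape.up ℤ)).obj P.cochainComplex ⟶
          (HomotopyCategory.quotient _ (ComplexShape.up ℤ)).obj C'),
        boundedProj R C' ∧ C'.IsStrictlyGE 0 ∧ f = g ≫ (HomotopyCategory.quotient _ _).map i := by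
  induction n with
  | zero => exact fun C hC hC' f => ⟨C, 𝟙 C, f, hC, by simpa using hC', by simp⟩
  | succ n ih =>
    intro C hC hC' f
    obtain ⟨C₁, i, p, hC₁, hC₁', h⟩ := exists_subcomplex_isStrictlyGE_succ C hC (-(n + 1 : ℕ))
    have := (hC.2.2 (-(n + 1 : ℕ))).1
    have := (hC.2.2 (-(n + 1 : ℕ))).2
    -- The lowest term sits in degree `-(n + 1) < 0`, so the component of `f` there vanishes and `f`
    -- lifts to the complex without that term.
    obtain ⟨g, rfl⟩ := h _ f (quotient_hom_single_eq_zero hM P _ _ (by lia) _)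
    obtain ⟨C₂, j, g', h₁, h₂, rfl⟩ := ih C₁ hC₁ (by convert hC₁' using 1; push_cast; ring) g
    exact ⟨C₂, j ≫ i, g', h₁, h₂, by simp⟩

/-! ### Calculus of fractions in the singularity category -/

lemma boundedProj.kMinusBProj {C : CochainComplex (ModuleCat.{u} R) ℤ} (hC : boundedProj R C) :
    kMinusBProj R ((HomotopyCategory.quotient _ _).obj C) := by
  refine ⟨?_, (kMinusProj_quotient_iff _).2 hC.2⟩
  obtain ⟨⟨a, _⟩, ⟨b, _⟩, -⟩ := hC
  refine ⟨a, b, fun n hn => ?_⟩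
  refine IsZero.of_iso ?_ ((HomotopyCategory.homologyFunctorFactors (ModuleCat.{u} R)
    (ComplexShape.up ℤ) n).app C)
  obtain hn | hn := hn
  · exact C.isZero_of_isGE a n hn
  · exact C.isZero_of_isLE b n hn

/-- A bounded complex of finitely generated projective modules, as an object of
`K^{-,b}(R-proj)`. -/
def boundedProj.toKMinusB {C : CochainComplex (ModuleCat.{u} R) ℤ} (hC : boundedProj R C) :
    KMinusB R where
  obj := (HomotopyCategory.quotient _ _).obj C
  property := hC.kMinusBProj

lemma boundedProj.perfectObjects_toKMinusB {C : CochainComplex (ModuleCat.{u} R) ℤ}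
    (hC : boundedProj R C) : perfectObjects R hC.toKMinusB :=
  ObjectProperty.le_isoClosure _ _ ((kBoundedProj_quotient_iff C).2 hC)

lemma SingularityCategory.isZero_Q_obj {X : KMinusB R} (hX : perfectObjects R X) :
    IsZero ((SingularityCategory.Q R).obj X) := by
  have h : (perfectObjects R).trW (0 : X ⟶ (0 : KMinusB R)) := by
    rw [ObjectProperty.trW_iff']
    exact ⟨X, 𝟙 X, 0, contractible_distinguished X, hX⟩
  have := Localization.inverts (SingularityCategory.Q R) _ _ h
  exact ((SingularityCategory.Q R).map_isZero (isZero_zero _)).of_iso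
    (asIso ((SingularityCategory.Q R).map (0 : X ⟶ (0 : KMinusB R))))

variable {M : ModuleCat.{u} R}

lemma FGProjectiveResolution.exists_factor_of_perfectObjects
    (hM : leftPerp R M) (P : FGProjectiveResolution M) {X : KMinusB R}
    (hX : perfectObjects R X) (f : P.toKMinusB ⟶ X) :
    ∃ (C : CochainComplex (ModuleCat.{u} R) ℤ) (hC : boundedProj R C) (_ : C.IsStrictlyGE 0)
      (g : P.toKMinusB ⟶ hC.toKMinusB) (h : hC.toKMinusB ⟶ X), f = g ≫ h := by
  obtain ⟨_, ⟨C, hC⟩, ⟨e⟩⟩ := hX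
  obtain ⟨⟨a, ha⟩, _⟩ := id hC
  -- The number of negative degrees to strip; `toNat` gives `0` if `C` already starts in degree `a ≥
  -- 0`.
  have hC' : C.IsStrictlyGE (-((-a).toNat : ℤ)) := C.isStrictlyGE_of_ge _ a (by lia)
  obtain ⟨C', i, g, h₁, h₂, h₃⟩ := exists_factor_isStrictlyGE_zero hM P.toProjectiveResolution _ C hC
    hC' (f.hom ≫ e.hom)
  refine ⟨C', h₁, h₂, ObjectProperty.homMk g,
    ObjectProperty.homMk ((HomotopyCategory.quotient _ _).map i ≫ e.inv), ?_⟩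
  ext1
  exact ((Iso.eq_comp_inv e).2 h₃).trans (Category.assoc _ _ _)

/-- The vanishing of all morphisms to `Y` from bounded complexes of finitely generated projective
modules which are concentrated in degrees `≥ n`. -/
def IsRightOrthogonalGE (Y : KMinusB R) (n : ℤ) : Prop :=
  ∀ (C : CochainComplex (ModuleCat.{u} R) ℤ) (_ : boundedProj R C) (_ : C.IsStrictlyGE n)
    (f : (HomotopyCategory.quotient _ _).obj C ⟶ Y.obj), f = 0

lemma isRightOrthogonalGE_of_isStrictlyLE {Y : KMinusB R}
    (L : CochainComplex (ModuleCat.{u} R) ℤ) (e : Y.obj ≅ (HomotopyCategory.quotient _ _).obj L)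
    (b n : ℤ) (h : b < n) [L.IsStrictlyLE b] : IsRightOrthogonalGE Y n := by
  intro C hC _ f
  rw [← cancel_mono e.hom, zero_comp]
  exact quotient_hom_eq_zero_of_isStrictlyGE_of_isStrictlyLE n b h _

/-- Given a fraction, the map from `P` to the cone of the denominator factors through some `C'` in
degrees `≥ 0`, so the fibre `P'` of `P ⟶ C'` refines the denominator. The obstruction to extending
the numerator from `P'` to `P` is a map from `C'⟦-1⟧` to `Y`. It is zero because `C'⟦-1⟧` lies in
degrees `≥ 1`. -/
lemma FGProjectiveResolution.Q_map_surjective (hM : leftPerp R M)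
    (P : FGProjectiveResolution M) {Y : KMinusB R} (hY : IsRightOrthogonalGE Y 1) :
    Function.Surjective ((SingularityCategory.Q R).map : (P.toKMinusB ⟶ Y) → _) := by
  intro f
  obtain ⟨φ, rfl⟩ := Localization.exists_rightFraction (SingularityCategory.Q R)
    (perfectObjects R).trW f
  obtain ⟨C, a, b, hT, hC⟩ := (ObjectProperty.trW_iff _ _).1 φ.hs
  obtain ⟨C', hC', _, p, q, rfl⟩ := P.exists_factor_of_perfectObjects hM hC a
  obtain ⟨P', s, c, hT'⟩ := distinguished_cocone_triangle₁ p
  have hs : (perfectObjects R).trW s :=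
    (ObjectProperty.trW_iff _ _).2 ⟨_, _, _, hT', hC'.perfectObjects_toKMinusB⟩
  obtain ⟨t : P' ⟶ φ.X', ht, -⟩ := complete_distinguished_triangle_morphism₁ _ _ hT' hT (𝟙 _) q
    (Category.id_comp _).symm
  obtain ⟨g, hg⟩ : ∃ g, t ≫ φ.f = s ≫ g := by
    refine Triangle.yoneda_exact₂ _ (inv_rot_of_distTriang _ hT') (t ≫ φ.f) ?_
    have h := hY (C'⟦(-1 : ℤ)⟧) ⟨⟨1, C'.isStrictlyGE_shift 0 (-1) 1 (by lia)⟩,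
      boundedAboveProj_shift _ hC'.2⟩ (C'.isStrictlyGE_shift 0 (-1) 1 (by lia))
    have h' (x : hC'.toKMinusB⟦(-1 : ℤ)⟧ ⟶ Y) : x = 0 := by
      let e : (HomotopyCategory.quotient _ _).obj (C'⟦(-1 : ℤ)⟧) ≅ (hC'.toKMinusB⟦(-1 : ℤ)⟧).obj :=
        ((HomotopyCategory.quotient _ _).commShiftIso (-1 : ℤ)).app C' ≪≫
          ((kMinusBProj R).ι.commShiftIso (-1 : ℤ)).symm.app hC'.toKMinusB
      ext1
      rw [← cancel_epi e.hom, h (e.hom ≫ x.hom)]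
      exact comp_zero.symm
    exact h' _
  refine ⟨g, ?_⟩
  have := Localization.inverts (SingularityCategory.Q R) _ _ hs
  have := Localization.inverts (SingularityCategory.Q R) _ _ φ.hs
  rw [← cancel_epi ((SingularityCategory.Q R).map s), ← Functor.map_comp, ← hg]
  have ht : s = t ≫ φ.s := (Category.comp_id s).symm.trans ht
  rw [ht, Functor.map_comp _ t φ.s, Functor.map_comp _ t φ.f, Category.assoc,
    MorphismProperty.RightFraction.map_s_comp_map]

/-- A killed map already dies on some `P' ⟶ P` with perfect cone, hence factors through this cone,
and `P` reaches the cone through a complex in degrees `≥ 0`. Conversely, perfect objects become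
zero. -/
lemma FGProjectiveResolution.Q_map_eq_zero_iff (hM : leftPerp R M)
    (P : FGProjectiveResolution M) {Y : KMinusB R} (g : P.toKMinusB ⟶ Y) :
    (SingularityCategory.Q R).map g = 0 ↔
      ∃ (C : CochainComplex (ModuleCat.{u} R) ℤ) (hC : boundedProj R C) (_ : C.IsStrictlyGE 0)
        (a : P.toKMinusB ⟶ hC.toKMinusB) (b : hC.toKMinusB ⟶ Y), g = a ≫ b := by
  constructor
  · intro h
    rw [← Functor.map_zero, MorphismProperty.map_eq_iff_precomp _ (perfectObjects R).trW] at h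
    obtain ⟨P', s, hs, h⟩ := h
    obtain ⟨C, a, b, hT, hC⟩ := (ObjectProperty.trW_iff _ _).1 hs
    obtain ⟨C', hC', hC₀, p, q, rfl⟩ := P.exists_factor_of_perfectObjects hM hC a
    obtain ⟨k, hk⟩ := Triangle.yoneda_exact₂ _ hT g (h.trans comp_zero)
    exact ⟨C', hC', hC₀, p, q ≫ k, hk.trans (Category.assoc _ _ _)⟩
  · rintro ⟨C, hC, -, a, b, rfl⟩
    rw [Functor.map_comp,
      (SingularityCategory.isZero_Q_obj hC.perfectObjects_toKMinusB).eq_zero_of_tgt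
        ((SingularityCategory.Q R).map a), zero_comp]

lemma FGProjectiveResolution.Q_map_bijective (hM : leftPerp R M)
    (P : FGProjectiveResolution M) {Y : KMinusB R} (hY : IsRightOrthogonalGE Y 0) :
    Function.Bijective ((SingularityCategory.Q R).map : (P.toKMinusB ⟶ Y) → _) := by
  refine ⟨?_, P.Q_map_surjective hM fun C hC h f => hY C hC (C.isStrictlyGE_of_ge 0 1 (by lia)) f⟩
  have : Function.Injective ((SingularityCategory.Q R).mapAddHom :
      (P.toKMinusB ⟶ Y) →+ _) := by
    rw [injective_iff_map_eq_zero]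
    intro g hg
    obtain ⟨C, hC, h, a, b, rfl⟩ := (P.Q_map_eq_zero_iff hM g).1 hg
    have hb : b = 0 := by
      ext1
      exact hY C hC h b.hom
    rw [hb, comp_zero]
  exact this

/-- Postcomposition with an isomorphism, as an additive equivalence. -/
@[simps!]
def CategoryTheory.Iso.postcompAddEquiv {C : Type*} [Category* C] [Preadditive C] (X : C) {Y Z : C}
    (e : Y ≅ Z) : (X ⟶ Y) ≃+ (X ⟶ Z) where
  toFun f := f ≫ e.hom
  invFun f := f ≫ e.inv
  left_inv f := by simp
  right_inv f := by simp
  map_add' f g := by simp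

/-- In a full subcategory, morphisms are the morphisms of the ambient category. -/
@[simps!]
def CategoryTheory.ObjectProperty.homAddEquiv {C : Type*} [Category* C] [Preadditive C]
    (P : ObjectProperty C) (X Y : P.FullSubcategory) : (X ⟶ Y) ≃+ (X.obj ⟶ Y.obj) where
  toFun f := f.hom
  invFun f := ObjectProperty.homMk f
  left_inv _ := rfl
  right_inv _ := rfl
  map_add' _ _ := rfl

/-- A map to a complex concentrated in degree `i` is determined by its component there. This turns a
chain map from a complex starting in degree `i` into a map of objects. -/
lemma HomologicalComplex.hom_single_eq_mkHomToSingle_comp {V ι : Type*} [Category* V]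
    [HasZeroMorphisms V] [HasZeroObject V] [DecidableEq ι] {c : ComplexShape ι} {i : ι}
    {K : HomologicalComplex V c} {A : V} (β : K ⟶ (single V c i).obj A)
    (h : ∀ j, c.Rel j i → K.d j i ≫ 𝟙 _ = 0) :
    β = mkHomToSingle (𝟙 _) h ≫ (single V c i).map (β.f i ≫ (singleObjXSelf c i A).hom) :=
  to_single_hom_ext (by simp [-Functor.map_comp, single_map_f_self])

/-! ### Homotopy category versus derived category -/

section

variable {C : Type*} [Category* C] [Abelian C]

instance DerivedCategory.isIso_Qh_map_quotient_map [HasDerivedCategory C]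
    {K L : CochainComplex C ℤ} (f : K ⟶ L) [QuasiIso f] :
    IsIso (DerivedCategory.Qh.map ((HomotopyCategory.quotient _ (ComplexShape.up ℤ)).map f)) :=
  (NatIso.isIso_map_iff (DerivedCategory.quotientCompQhIso C) f).2
    ((DerivedCategory.isIso_Q_map_iff_quasiIso _ f).2 inferInstance)

/-- The single functor to the derived category factors through the homotopy category. -/
noncomputable def DerivedCategory.singleFunctorIsoCompQh [HasDerivedCategory C] :
    DerivedCategory.singleFunctor C 0 ≅
      CochainComplex.singleFunctor C 0 ⋙ HomotopyCategory.quotient _ _ ⋙ DerivedCategory.Qh :=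
  DerivedCategory.singleFunctorIsoCompQ C 0 ≪≫
    Functor.isoWhiskerLeft (CochainComplex.singleFunctor C 0)
      (DerivedCategory.quotientCompQhIso C).symm

attribute [local instance] HasDerivedCategory.standard in
-- Maps out of a K-projective complex agree in the homotopy and derived categories, and in the
-- latter `f` is invertible.
lemma CochainComplex.comp_quotient_map_bijective (K : CochainComplex C ℤ) [K.IsKProjective]
    {L L' : CochainComplex C ℤ} (f : L ⟶ L') [QuasiIso f] :
    Function.Bijective (fun g : (HomotopyCategory.quotient _ (ComplexShape.up ℤ)).obj K ⟶
      (HomotopyCategory.quotient _ (ComplexShape.up ℤ)).obj L =>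
        g ≫ (HomotopyCategory.quotient _ _).map f) := by
  have h₁ := CochainComplex.IsKProjective.Qh_map_bijective K
    ((HomotopyCategory.quotient _ _).obj L)
  have h₂ := CochainComplex.IsKProjective.Qh_map_bijective K
    ((HomotopyCategory.quotient _ _).obj L')
  rw [← Function.Bijective.of_comp_iff' h₂]
  have h₃ := ((asIso (DerivedCategory.Qh.map
      ((HomotopyCategory.quotient _ (ComplexShape.up ℤ)).map f))).postcompAddEquiv
    (DerivedCategory.Qh.obj ((HomotopyCategory.quotient _ _).obj K))).bijective.comp h₁
  convert! h₃ using 1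
  ext g
  simp

attribute [local instance] HasDerivedCategory.standard in
-- Pass to the derived category, where `P.π'` is invertible and objects in degree `0` embed fully
-- faithfully.
lemma CategoryTheory.ProjectiveResolution.map_π'_comp_single_bijective {X : C}
    (P : ProjectiveResolution X) (Y : C) :
    Function.Bijective (fun f : X ⟶ Y =>
      (HomotopyCategory.quotient _ (ComplexShape.up ℤ)).map
        (P.π' ≫ (CochainComplex.singleFunctor C 0).map f)) := by
  have h₂ := CochainComplex.IsKProjective.Qh_map_bijective P.cochainComplex
    ((HomotopyCategory.quotient _ _).obj ((CochainComplex.singleFunctor C 0).obj Y))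
  rw [← Function.Bijective.of_comp_iff' h₂]
  let F : C ⥤ DerivedCategory C :=
    CochainComplex.singleFunctor C 0 ⋙ HomotopyCategory.quotient _ _ ⋙ DerivedCategory.Qh
  have : F.Full := Functor.Full.of_iso DerivedCategory.singleFunctorIsoCompQh
  have : F.Faithful := Functor.Faithful.of_iso DerivedCategory.singleFunctorIsoCompQh
  have hF : Function.Bijective (F.map : (X ⟶ Y) → _) := ⟨F.map_injective, F.map_surjective⟩
  have h₃ := (((asIso (DerivedCategory.Qh.map
      ((HomotopyCategory.quotient _ (ComplexShape.up ℤ)).map P.π'))).homFromEquiv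
        (Z := F.obj Y)).symm.bijective).comp hF
  convert! h₃ using 1
  ext f
  exact (congr_arg _ (Functor.map_comp _ _ _)).trans (Functor.map_comp _ _ _)

lemma CategoryTheory.ProjectiveResolution.map_π'_comp_single_comp {X Y Z : C}
    (P : ProjectiveResolution X) (g : X ⟶ Y) (h : Y ⟶ Z) :
    (HomotopyCategory.quotient _ (ComplexShape.up ℤ)).map
        (P.π' ≫ (CochainComplex.singleFunctor C 0).map (g ≫ h)) =
      (HomotopyCategory.quotient _ (ComplexShape.up ℤ)).map
        (P.π' ≫ (CochainComplex.singleFunctor C 0).map g) ≫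
      (HomotopyCategory.quotient _ (ComplexShape.up ℤ)).map
        ((CochainComplex.singleFunctor C 0).map h) := by
  rw [← Functor.map_comp (HomotopyCategory.quotient _ _), Category.assoc, ← Functor.map_comp]

end

/-! ### Nonnegative shifts: `Ext` and stable maps -/

namespace FGProjectiveResolution

variable {M N : ModuleCat.{u} R}

/-- The shift of a module in `D_sg(R)`, described in terms of the shift of a resolution. -/
noncomputable def singObjShiftIso (Q : FGProjectiveResolution N) (n : ℤ) :
    (SingularityCategory.Q R).obj (Q.toKMinusB⟦n⟧) ≅ Q.singObj⟦n⟧ :=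
  ((SingularityCategory.Q R).commShiftIso n).app Q.toKMinusB

/-- The shift in `K^{-,b}(R-proj)` of a resolution is its shift as a cochain complex. -/
noncomputable def toKMinusBShiftIso (Q : FGProjectiveResolution N) (n : ℤ) :
    (Q.toKMinusB⟦n⟧).obj ≅
      (HomotopyCategory.quotient _ _).obj (Q.toProjectiveResolution.cochainComplex⟦n⟧) :=
  ((kMinusBProj R).ι.commShiftIso n).app Q.toKMinusB ≪≫
    ((HomotopyCategory.quotient _ _).commShiftIso n).symm.app _

/-- The shifted resolution of `N` lies in degrees `≤ -n < 0`, so no map from a complex in degrees `≥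
0` reaches it and passing to the quotient changes nothing. Replacing the resolution by `N` itself
then gives the usual description of `Ext`. -/
lemma nonempty_addEquiv_ext (hM : leftPerp R M)
    (P : FGProjectiveResolution M) (Q : FGProjectiveResolution N) (n : ℕ) (hn : 1 ≤ n) :
    Nonempty ((P.singObj ⟶ Q.singObj⟦(n : ℤ)⟧) ≃+ Abelian.Ext M N n) := by
  have : (Q.toProjectiveResolution.cochainComplex⟦(n : ℤ)⟧).IsStrictlyLE (-n) :=
    CochainComplex.isStrictlyLE_shift _ 0 n (-n) (by lia)
  have h₁ := P.Q_map_bijective hM (isRightOrthogonalGE_of_isStrictlyLE _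
    (Q.toKMinusBShiftIso n) (-n) 0 (by lia))
  let e₁ : (P.toKMinusB ⟶ Q.toKMinusB⟦(n : ℤ)⟧) ≃+
      (P.singObj ⟶ (SingularityCategory.Q R).obj (Q.toKMinusB⟦(n : ℤ)⟧)) :=
    AddEquiv.ofBijective ((SingularityCategory.Q R).mapAddHom) h₁
  have : QuasiIso (Q.toProjectiveResolution.π'⟦(n : ℤ)⟧') := inferInstance
  let e₂ := AddEquiv.ofBijective (Preadditive.rightComp _ _)
    (CochainComplex.comp_quotient_map_bijective P.toProjectiveResolution.cochainComplex
    (Q.toProjectiveResolution.π'⟦(n : ℤ)⟧'))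
  let e₃ := (P.toProjectiveResolution.extAddEquivCohomologyClass (Y := N) (n := n)).trans
    CochainComplex.HomComplex.CohomologyClass.homAddEquiv
  exact ⟨((Q.singObjShiftIso n).symm.postcompAddEquiv P.singObj).trans <| e₁.symm.trans <|
    (ObjectProperty.homAddEquiv _ _ _).trans <|
    ((Q.toKMinusBShiftIso n).postcompAddEquiv P.toKMinusB.obj).trans <| e₂.trans e₃.symm⟩

/-- Morphisms between modules are the morphisms between their resolutions in `K^{-,b}(R-proj)`. -/
noncomputable def homAddEquiv (P : FGProjectiveResolution M) (Q : FGProjectiveResolution N) :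
    (M ⟶ N) ≃+ (P.toKMinusB ⟶ Q.toKMinusB) :=
  (AddEquiv.ofBijective
    (AddMonoidHom.mk' (fun f : M ⟶ N => (HomotopyCategory.quotient _ (ComplexShape.up ℤ)).map
        (P.π' ≫ (CochainComplex.singleFunctor _ 0).map f)) (by intro f g; simp))
    (P.map_π'_comp_single_bijective N)).trans
  ((AddEquiv.ofBijective (Preadditive.rightComp _ _)
    (CochainComplex.comp_quotient_map_bijective P.toProjectiveResolution.cochainComplex
    Q.toProjectiveResolution.π')).symm.trans
    (ObjectProperty.homAddEquiv (kMinusBProj R) P.toKMinusB Q.toKMinusB).symm)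

lemma homAddEquiv_hom_comp (P : FGProjectiveResolution M) (Q : FGProjectiveResolution N)
    (f : M ⟶ N) : (P.homAddEquiv Q f).hom ≫ (HomotopyCategory.quotient _ _).map Q.π' =
      (HomotopyCategory.quotient _ (ComplexShape.up ℤ)).map
        (P.π' ≫ (CochainComplex.singleFunctor _ 0).map f) :=
  (AddEquiv.ofBijective (Preadditive.rightComp _ _)
    (CochainComplex.comp_quotient_map_bijective P.toProjectiveResolution.cochainComplex
    Q.toProjectiveResolution.π')).apply_symm_apply _

lemma eq_of_comp_map_π' (Q : FGProjectiveResolution N) {K : CochainComplex (ModuleCat.{u} R) ℤ}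
    [K.IsKProjective]
    {f g : (HomotopyCategory.quotient _ (ComplexShape.up ℤ)).obj K ⟶ Q.toKMinusB.obj}
    (h : f ≫ (HomotopyCategory.quotient _ _).map Q.π' =
      g ≫ (HomotopyCategory.quotient _ _).map Q.π') : f = g :=
  (CochainComplex.comp_quotient_map_bijective K Q.π').1 h

lemma _root_.boundedProj_single (F : ModuleCat.{u} R) [Module.Finite R F] [Module.Projective R F] :
    boundedProj R ((CochainComplex.singleFunctor _ 0).obj F) := by
  refine ⟨⟨0, inferInstance⟩, ⟨0, inferInstance⟩, fun i => ?_⟩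
  by_cases hi : i = 0
  · subst hi
    let e := (HomologicalComplex.singleObjXSelf (ComplexShape.up ℤ) 0 F).toLinearEquiv.symm
    exact ⟨Module.Finite.equiv e, Module.Projective.of_equiv e⟩
  · have := ModuleCat.isZero_iff_subsingleton.1
      (HomologicalComplex.isZero_single_obj_X (ComplexShape.up ℤ) 0 F i hi)
    exact ⟨inferInstanceAs (Module.Finite R
      (((HomologicalComplex.single _ (ComplexShape.up ℤ) 0).obj F).X i)),
      inferInstanceAs (Module.Projective R
      (((HomologicalComplex.single _ (ComplexShape.up ℤ) 0).obj F).X i))⟩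

lemma _root_.boundedAboveProj.isKProjective {K : CochainComplex (ModuleCat.{u} R) ℤ}
    (hK : boundedAboveProj R K) : K.IsKProjective := by
  obtain ⟨⟨n, _⟩, h⟩ := hK
  have (i : ℤ) : Projective (K.X i) := (IsProjective.iff_projective _).1 (h i).2
  exact CochainComplex.isKProjective_of_projective K n

/-- If the lift of `f` factors through `C` in degrees `≥ 0`, the composite from `C` to the
resolution and on to `N` only involves `C.X 0`, so `f` factors through this projective. Conversely,
a projective in degree `0` is K-projective, so a map from it to `N` lifts to the resolution. -/
lemma Q_map_homAddEquiv_eq_zero_iff (hM : leftPerp R M) (P : FGProjectiveResolution M)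
    (Q : FGProjectiveResolution N) (f : M ⟶ N) :
    (SingularityCategory.Q R).map (P.homAddEquiv Q f) = 0 ↔
      f.hom ∈ factorsThroughProj R M N := by
  rw [P.Q_map_eq_zero_iff hM]
  constructor
  · rintro ⟨C, hC, hC₀, a, b, hab⟩
    let p : C ⟶ (CochainComplex.singleFunctor (ModuleCat.{u} R) 0).obj (C.X 0) :=
      HomologicalComplex.mkHomToSingle (𝟙 _)
        (fun j hj => (C.isZero_of_isStrictlyGE 0 j (by simp at hj; lia)).eq_of_src _ _)
    obtain ⟨β, hβ⟩ := (HomotopyCategory.quotient _ _).map_surjective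
      (b.hom ≫ (HomotopyCategory.quotient _ _).map Q.π')
    obtain ⟨g, hg⟩ := (P.map_π'_comp_single_bijective (C.X 0)).2
      (a.hom ≫ (HomotopyCategory.quotient _ _).map p)
    let h : C.X 0 ⟶ N := β.f 0 ≫ (HomologicalComplex.singleObjXSelf (ComplexShape.up ℤ) 0 N).hom
    have hp : β = p ≫ (CochainComplex.singleFunctor _ 0).map h := 
      HomologicalComplex.hom_single_eq_mkHomToSingle_comp β _
    refine ⟨C.X 0, inferInstance, inferInstance, (hC.2.2 0).1, (hC.2.2 0).2, g.hom, h.hom, ?_⟩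
    rw [← ModuleCat.hom_comp]
    congr 1
    apply (P.map_π'_comp_single_bijective N).1
    refine (P.map_π'_comp_single_comp g h).trans (Eq.trans ?_ (P.homAddEquiv_hom_comp Q f))
    rw [hab]
    refine (congr_arg (· ≫ _) hg).trans ((Category.assoc _ _ _).trans
      (Eq.trans ?_ (Category.assoc _ _ _).symm))
    exact congr_arg (a.hom ≫ ·) (((Functor.map_comp _ _ _).symm.trans
      (congr_arg (HomotopyCategory.quotient _ _).map hp.symm)).trans hβ)
  · rintro ⟨F, _, _, _, _, g, h, hgh⟩
    have hF := boundedProj_single (ModuleCat.of R F)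
    have := hF.2.isKProjective
    obtain ⟨b, hb⟩ := (CochainComplex.comp_quotient_map_bijective
      ((CochainComplex.singleFunctor _ 0).obj (ModuleCat.of R F)) Q.π').2
      ((HomotopyCategory.quotient _ _).map
        ((CochainComplex.singleFunctor _ 0).map (ModuleCat.ofHom h)))
    refine ⟨_, hF, inferInstance, ObjectProperty.homMk ((HomotopyCategory.quotient _ _).map
      (P.π' ≫ (CochainComplex.singleFunctor _ 0).map (ModuleCat.ofHom g))),
      ObjectProperty.homMk b, ?_⟩
    ext1
    apply Q.eq_of_comp_map_π'
    refine (P.homAddEquiv_hom_comp Q f).trans (Eq.trans ?_ (Category.assoc _ _ _).symm)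
    refine Eq.trans ?_ (congr_arg (_ ≫ ·) hb.symm)
    have : f = ModuleCat.ofHom g ≫ ModuleCat.ofHom h := by
      ext1
      exact hgh.symm
    rw [this]
    exact P.map_π'_comp_single_comp _ _

/-- Morphisms in the singularity category between modules. -/
noncomputable def stableHomEquiv (hM : leftPerp R M) (P : FGProjectiveResolution M)
    (Q : FGProjectiveResolution N) : StableHom R M N ≃+ (P.singObj ⟶ Q.singObj) :=
  -- The bound is `1` because `Q` may be nonzero in degree `0`: surjectivity survives, injectivity
  -- does not.
  have hQ : IsRightOrthogonalGE Q.toKMinusB 1 :=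
    isRightOrthogonalGE_of_isStrictlyLE Q.toProjectiveResolution.cochainComplex
      (Iso.refl _) 0 1 (by lia)
  let φ : (M →ₗ[R] N) →+ (P.singObj ⟶ Q.singObj) :=
    ((SingularityCategory.Q R).mapAddHom.comp (P.homAddEquiv Q).toAddMonoidHom).comp
      (ModuleCat.homAddEquiv (M := M) (N := N)).symm.toAddMonoidHom
  (QuotientAddGroup.quotientAddEquivOfEq (by
    ext f
    exact (Q_map_homAddEquiv_eq_zero_iff hM P Q (ModuleCat.ofHom f)).symm)).trans
  (QuotientAddGroup.quotientKerEquivOfSurjective φ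
    ((P.Q_map_surjective hM hQ).comp ((P.homAddEquiv Q).surjective.comp
      (AddEquiv.surjective _))))

end FGProjectiveResolution

/-! ### Dimension shifting -/

section

variable {C : Type*} [Category* C] [Abelian C]

lemma CochainComplex.IsKProjective.nonempty_iso_of_Qh_iso [HasDerivedCategory C]
    (K L : CochainComplex C ℤ) [K.IsKProjective] [L.IsKProjective]
    (e : DerivedCategory.Qh.obj ((HomotopyCategory.quotient _ _).obj K) ≅
      DerivedCategory.Qh.obj ((HomotopyCategory.quotient _ _).obj L)) :
    Nonempty ((HomotopyCategory.quotient _ (ComplexShape.up ℤ)).obj K ≅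
      (HomotopyCategory.quotient _ (ComplexShape.up ℤ)).obj L) := by
  obtain ⟨f, hf⟩ := (Qh_map_bijective K _).2 e.hom
  obtain ⟨g, hg⟩ := (Qh_map_bijective L _).2 e.inv
  exact ⟨⟨f, g, (Qh_map_bijective K _).1 (by simp [hf, hg]),
    (Qh_map_bijective L _).1 (by simp [hf, hg])⟩⟩

/-- A projective resolution of `X`, viewed in the derived category, is isomorphic to `X`. -/
noncomputable def CategoryTheory.ProjectiveResolution.QhIso [HasDerivedCategory C] {X : C}
    (P : ProjectiveResolution X) :
    DerivedCategory.Qh.obj ((HomotopyCategory.quotient _ _).obj P.cochainComplex) ≅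
      (DerivedCategory.singleFunctor C 0).obj X :=
  asIso (DerivedCategory.Qh.map ((HomotopyCategory.quotient _ (ComplexShape.up ℤ)).map P.π')) ≪≫
    (DerivedCategory.singleFunctorIsoCompQh.app X).symm

end

namespace FGProjectiveResolution

attribute [local instance] HasDerivedCategory.standard in
/-- The resolution of the third term of a short exact sequence with projective middle term is the
cone of a morphism from the resolution of the first term. -/
lemma nonempty_iso_cone_of_shortExact {S : ShortComplex (ModuleCat.{u} R)}
    (hS : S.ShortExact) [Module.Finite R S.X₂] [Module.Projective R S.X₂]
    (Q₁ : FGProjectiveResolution S.X₁) (Q₃ : FGProjectiveResolution S.X₃)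
    (E : KMinusB R) (v : (boundedProj_single S.X₂).toKMinusB ⟶ E) (w : E ⟶ Q₁.toKMinusB⟦(1 : ℤ)⟧)
    (hT : Triangle.mk (ObjectProperty.homMk ((HomotopyCategory.quotient _ (ComplexShape.up ℤ)).map
      (Q₁.π' ≫ (CochainComplex.singleFunctor _ 0).map S.f))) v w ∈ distTriang (KMinusB R)) :
    Nonempty (E ≅ Q₃.toKMinusB) := by
  have hT₁ := DerivedCategory.Qh.map_distinguished _ ((kMinusBProj R).ι.map_distinguished _ hT)
  -- In the derived category, the triangle of the cone and that of the short exact sequence share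
  -- their first map up to isomorphism, hence also their third object.
  let e := isoTriangleOfIso₁₂ _ _ hT₁ hS.singleTriangle_distinguished
    Q₁.toProjectiveResolution.QhIso (DerivedCategory.singleFunctorIsoCompQh.app S.X₂).symm
    ((congr_arg (· ≫ DerivedCategory.singleFunctorIsoCompQh.inv.app S.X₂)
      ((congr_arg DerivedCategory.Qh.map (Functor.map_comp _ _ _)).trans
        (Functor.map_comp _ _ _))).trans ((Category.assoc _ _ _).trans
      ((congr_arg (_ ≫ ·) (DerivedCategory.singleFunctorIsoCompQh.inv.naturality S.f)).trans
        (Category.assoc _ _ _).symm)))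
  -- `kMinusProj` is a strict image, so the complex underlying `E` is itself bounded above with
  -- projective terms. It is therefore K-projective, and the isomorphism descends to the homotopy
  -- category.
  have hE : boundedAboveProj R E.obj.as :=
    (kMinusProj_quotient_iff _).1 (E.property.2)
  have := hE.isKProjective
  obtain ⟨e'⟩ := CochainComplex.IsKProjective.nonempty_iso_of_Qh_iso E.obj.as Q₃.cochainComplex
    (Triangle.π₃.mapIso e ≪≫ Q₃.toProjectiveResolution.QhIso.symm)
  exact ⟨(kMinusBProj R).isoMk e'⟩

/-- Dimension shifting in the singularity category. -/
lemma nonempty_shift_iso_of_shortExact {S : ShortComplex (ModuleCat.{u} R)}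
    (hS : S.ShortExact) [Module.Finite R S.X₂] [Module.Projective R S.X₂]
    (Q₁ : FGProjectiveResolution S.X₁) (Q₃ : FGProjectiveResolution S.X₃) :
    Nonempty (Q₃.singObj ≅ Q₁.singObj⟦(1 : ℤ)⟧) := by
  let f : Q₁.toKMinusB ⟶ (boundedProj_single S.X₂).toKMinusB :=
    ObjectProperty.homMk ((HomotopyCategory.quotient _ (ComplexShape.up ℤ)).map
      (Q₁.π' ≫ (CochainComplex.singleFunctor _ 0).map S.f))
  obtain ⟨E, v, w, hT⟩ := distinguished_cocone_triangle f
  obtain ⟨e⟩ := nonempty_iso_cone_of_shortExact hS Q₁ Q₃ E v w hT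
  -- After rotation, `w` sits in a triangle whose remaining object is the projective `S.X₂`, so the
  -- quotient functor inverts it.
  have hw : (perfectObjects R).trW w :=
    (ObjectProperty.trW_iff' _ _).2 ⟨_, _, _, rot_of_distTriang _ hT,
      (boundedProj_single S.X₂).perfectObjects_toKMinusB⟩
  have := Localization.inverts (SingularityCategory.Q R) _ _ hw
  exact ⟨(SingularityCategory.Q R).mapIso e.symm ≪≫ asIso ((SingularityCategory.Q R).map w) ≪≫
    Q₁.singObjShiftIso 1⟩

/-- The morphisms to the negative shifts of a module, in terms of a syzygy. -/
lemma nonempty_shift_addEquiv_of_shortExact {S : ShortComplex (ModuleCat.{u} R)}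
    (hS : S.ShortExact) [Module.Finite R S.X₂] [Module.Projective R S.X₂]
    (Q₁ : FGProjectiveResolution S.X₁) (Q₃ : FGProjectiveResolution S.X₃)
    (X : SingularityCategory R) (n m : ℤ) (h : n + 1 = m) :
    Nonempty ((X ⟶ Q₃.singObj⟦n⟧) ≃+ (X ⟶ Q₁.singObj⟦m⟧)) := by
  obtain ⟨e⟩ := nonempty_shift_iso_of_shortExact hS Q₁ Q₃
  exact ⟨((shiftFunctor _ n).mapIso e ≪≫
    (shiftFunctorAdd' (SingularityCategory R) 1 n m (by lia)).symm.app Q₁.singObj).postcompAddEquiv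
      X⟩

end FGProjectiveResolution

end

/-! ### The balanced tensor product and the canonical map -/

section

variable {R : Type u} [Ring R]

namespace BalancedTensor

variable {A : Type u} [AddCommGroup A] [Module Rᵐᵒᵖ A]
variable {N₁ N₂ N₃ : Type u} [AddCommGroup N₁] [Module R N₁] [AddCommGroup N₂] [Module R N₂]
  [AddCommGroup N₃] [Module R N₃]

lemma map_comp_apply (f : N₁ →ₗ[R] N₂) (g : N₂ →ₗ[R] N₃) (z : BalancedTensor R A N₁) :
    map R A g (map R A f z) = map R A (g ∘ₗ f) z :=
  DFunLike.congr_fun (hom_ext (f := (map R A g).comp (map R A f)) (g := map R A (g ∘ₗ f))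
    fun _ _ => rfl) z

lemma map_surjective {g : N₂ →ₗ[R] N₃} (hg : Function.Surjective g) :
    Function.Surjective (map R A g) := by
  intro z
  obtain ⟨z, rfl⟩ := QuotientAddGroup.mk_surjective z
  obtain ⟨y, rfl⟩ := LinearMap.lTensor_surjective A
    (g := g.toAddMonoidHom.toIntLinearMap) hg z
  exact ⟨QuotientAddGroup.mk y, rfl⟩

/-- A generating relation lifts by lifting its element of `N₃` along `g`. This lets right exactness
descend from the tensor product over `ℤ` to the balanced one. -/
lemma exists_of_map_mk_mem {g : N₂ →ₗ[R] N₃} (hg : Function.Surjective g) {z : A ⊗[ℤ] N₃}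
    (hz : z ∈ balancedRelations R A N₃) :
    ∃ y ∈ balancedRelations R A N₂,
      LinearMap.lTensor A g.toAddMonoidHom.toIntLinearMap y = z := by
  induction hz using AddSubgroup.closure_induction with
  | mem z hz =>
    obtain ⟨a, r, x, rfl⟩ := hz
    obtain ⟨x, rfl⟩ := hg x
    exact ⟨_, AddSubgroup.subset_closure ⟨a, r, x, rfl⟩, by simp⟩
  | zero => exact ⟨0, zero_mem _, map_zero _⟩
  | add z z' _ _ h h' =>
    obtain ⟨y, hy, rfl⟩ := h
    obtain ⟨y', hy', rfl⟩ := h'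
    exact ⟨y + y', add_mem hy hy', map_add _ _ _⟩
  | neg z _ h =>
    obtain ⟨y, hy, rfl⟩ := h
    exact ⟨-y, neg_mem hy, map_neg _ _⟩

/-- The functor `A ⊗_R -` is right exact. -/
lemma map_exact {f : N₁ →ₗ[R] N₂} {g : N₂ →ₗ[R] N₃} (hfg : Function.Exact f g)
    (hg : Function.Surjective g) : Function.Exact (map R A f) (map R A g) := by
  intro z
  constructor
  · intro hz
    obtain ⟨z, rfl⟩ := QuotientAddGroup.mk_surjective z
    obtain ⟨y, hy, hyz⟩ := exists_of_map_mk_mem hg ((QuotientAddGroup.eq_zero_iff _).1 hz)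
    have h := lTensor_exact A (f := f.toAddMonoidHom.toIntLinearMap)
      (g := g.toAddMonoidHom.toIntLinearMap) hfg hg
    -- Subtracting the lifted relation `y` makes the representative die before passing to the
    -- quotient, where exactness over `ℤ` applies.
    obtain ⟨x, hx⟩ := (h (z - y)).1 (by rw [map_sub, hyz]; exact sub_self _)
    refine ⟨QuotientAddGroup.mk x, ?_⟩
    refine (congr_arg (QuotientAddGroup.mk (s := balancedRelations R A N₂)) hx).trans ?_
    rw [QuotientAddGroup.mk_sub, (QuotientAddGroup.eq_zero_iff y).2 hy, sub_zero]
  · rintro ⟨x, rfl⟩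
    rw [map_comp_apply, hfg.linearMap_comp_eq_zero]
    exact DFunLike.congr_fun (hom_ext (f := map R A (0 : N₁ →ₗ[R] N₃)) (g := 0) fun a x => by
      simp) x

end BalancedTensor

section

variable {M N N' : Type u} [AddCommGroup M] [Module R M] [AddCommGroup N] [Module R N]
  [AddCommGroup N'] [Module R N']

lemma canonicalMap_map (f : N →ₗ[R] N') (z : BalancedTensor R (M →ₗ[R] R) N) :
    canonicalMap R M N' (BalancedTensor.map R _ f z) = f ∘ₗ canonicalMap R M N z := by
  refine DFunLike.congr_fun (BalancedTensor.hom_ext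
    (f := (canonicalMap R M N').comp (BalancedTensor.map R _ f))
    (g := (AddMonoidHom.mk' (fun h : M →ₗ[R] N => f ∘ₗ h) fun a b => LinearMap.comp_add _ _ _).comp
      (canonicalMap R M N)) fun a x => ?_) z
  ext y
  simp [canonicalMap_tmul]

variable (M) in
-- A finite dual basis `a i`, `b i` of `F` gives the inverse `f ↦ ∑ i, (a i ∘ f) ⊗ b i`. Nothing is
-- needed of `M`.
lemma canonicalMap_bijective (F : Type u) [AddCommGroup F] [Module R F] [Module.Finite R F]
    [Module.Projective R F] : Function.Bijective (canonicalMap R M F) := by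
  obtain ⟨k, π, hπ⟩ := Module.Finite.exists_fin' R F
  obtain ⟨s, hs⟩ := Module.projective_lifting_property π LinearMap.id hπ
  let a (i : Fin k) : F →ₗ[R] R := (LinearMap.proj i).comp s
  let b (i : Fin k) : F := π (Pi.single i 1)
  have hab (y : F) : ∑ i, a i y • b i = y := by
    have h1 : π (s y) = y := LinearMap.congr_fun hs y
    conv_rhs => rw [← h1, pi_eq_sum_univ' (s y), map_sum]
    simp [a, b]
  let ψ : (M →ₗ[R] F) →+ BalancedTensor R (M →ₗ[R] R) F :=
    AddMonoidHom.mk' (fun f => ∑ i, QuotientAddGroup.mk ((a i ∘ₗ f) ⊗ₜ[ℤ] b i)) (by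
      intro f g
      simp only [LinearMap.comp_add, TensorProduct.add_tmul, QuotientAddGroup.mk_add,
        Finset.sum_add_distrib])
  have h₁ : ψ.comp (canonicalMap R M F) = AddMonoidHom.id _ := by
    refine BalancedTensor.hom_ext fun f y => ?_
    change ∑ i, QuotientAddGroup.mk ((a i ∘ₗ f.smulRight y) ⊗ₜ[ℤ] b i) = QuotientAddGroup.mk _
    conv_rhs => rw [← hab y, TensorProduct.tmul_sum, QuotientAddGroup.mk_sum]
    refine Finset.sum_congr rfl fun i _ => ?_
    have : a i ∘ₗ f.smulRight y = MulOpposite.op (a i y) • f := by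
      ext x
      simp
    rw [this, ← sub_eq_zero, ← QuotientAddGroup.mk_sub, QuotientAddGroup.eq_zero_iff]
    exact AddSubgroup.subset_closure ⟨_, _, _, rfl⟩
  have h₂ (f : M →ₗ[R] F) : canonicalMap R M F (ψ f) = f := by
    ext x
    simp only [ψ, AddMonoidHom.mk'_apply, map_sum, LinearMap.sum_apply, canonicalMap_tmul]
    exact hab (f x)
  exact ⟨Function.LeftInverse.injective (g := ψ) (DFunLike.congr_fun h₁),
    Function.RightInverse.surjective (g := ψ) h₂⟩

variable (M) in
-- Every map from a projective to `N` lifts along `π`, so one cover tests factorization through all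
-- projectives.
lemma mem_factorsThroughProj_iff {F : Type u} [AddCommGroup F] [Module R F] [Module.Finite R F]
    [Module.Projective R F] {π : F →ₗ[R] N} (hπ : Function.Surjective π) (f : M →ₗ[R] N) :
    f ∈ factorsThroughProj R M N ↔ ∃ g : M →ₗ[R] F, π ∘ₗ g = f := by
  constructor
  · rintro ⟨P, _, _, _, _, g, h, rfl⟩
    obtain ⟨k, rfl⟩ := Module.projective_lifting_property π h hπ
    exact ⟨k ∘ₗ g, rfl⟩
  · rintro ⟨g, rfl⟩
    exact ⟨F, inferInstance, inferInstance, inferInstance, inferInstance, g, π, rfl⟩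

variable (M) in
/-- For a presentation `F₁ → F₀ → N → 0` by finitely generated projective modules, the kernel of
`φ_{M,N}` is the group of stable maps from `M` to the syzygy of `N`. -/
lemma nonempty_stableHom_addEquiv_ker {Z F₀ F₁ : Type u} [AddCommGroup Z] [Module R Z]
    [AddCommGroup F₀] [Module R F₀] [Module.Finite R F₀] [Module.Projective R F₀]
    [AddCommGroup F₁] [Module R F₁] [Module.Finite R F₁] [Module.Projective R F₁]
    {i : Z →ₗ[R] F₀} {p : F₀ →ₗ[R] N} {π : F₁ →ₗ[R] Z} (hi : Function.Injective i)
    (hip : Function.Exact i p) (hp : Function.Surjective p) (hπ : Function.Surjective π) :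
    Nonempty (StableHom R M Z ≃+ (canonicalMap R M N).ker) := by
  let e := AddEquiv.ofBijective _ (canonicalMap_bijective (R := R) M F₀)
  -- The map `Hom(M, Z) → Hom(M, F₀) ≃ M* ⊗ F₀ → M* ⊗ N`; its kernel and range are the two groups to
  -- be compared.
  let ψ : (M →ₗ[R] Z) →+ BalancedTensor R (M →ₗ[R] R) N :=
    ((BalancedTensor.map R _ p).comp e.symm.toAddMonoidHom).comp
      (AddMonoidHom.mk' (fun f : M →ₗ[R] Z => i ∘ₗ f) fun _ _ => LinearMap.comp_add _ _ _)
  have hψ (f : M →ₗ[R] Z) : ψ f = BalancedTensor.map R _ p (e.symm (i ∘ₗ f)) := rfl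
  have hker : factorsThroughProj R M Z = ψ.ker := by
    ext f
    rw [mem_factorsThroughProj_iff M hπ, AddMonoidHom.mem_ker, hψ]
    -- Right exactness for `F₁ → F₀ → N` identifies the kernel of `ψ` with the maps that lift to
    -- `F₁`.
    have hex : Function.Exact (i ∘ₗ π) p := by
      intro x
      rw [hip x]
      constructor
      · rintro ⟨z, rfl⟩
        obtain ⟨y, rfl⟩ := hπ z
        exact ⟨y, rfl⟩
      · rintro ⟨y, rfl⟩
        exact ⟨π y, rfl⟩
    rw [BalancedTensor.map_exact hex hp]
    constructor
    · rintro ⟨g, rfl⟩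
      obtain ⟨x, rfl⟩ := (canonicalMap_bijective M F₁).2 g
      refine ⟨x, e.injective ?_⟩
      rw [e.apply_symm_apply]
      exact canonicalMap_map _ _
    · rintro ⟨x, hx⟩
      refine ⟨canonicalMap R M F₁ x, ?_⟩
      have h : e (BalancedTensor.map R _ (i ∘ₗ π) x) = i ∘ₗ f := by
        rw [hx, e.apply_symm_apply]
      have h' : (i ∘ₗ π) ∘ₗ canonicalMap R M F₁ x = i ∘ₗ f := (canonicalMap_map _ _).symm.trans h
      ext y
      exact hi (LinearMap.congr_fun h' y)
  have hrange : ψ.range = (canonicalMap R M N).ker := by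
    ext z
    rw [AddMonoidHom.mem_ker]
    constructor
    · rintro ⟨f, rfl⟩
      rw [hψ, canonicalMap_map]
      change p ∘ₗ e (e.symm (i ∘ₗ f)) = 0
      rw [e.apply_symm_apply, ← LinearMap.comp_assoc, hip.linearMap_comp_eq_zero,
        LinearMap.zero_comp]
    · intro hz
      obtain ⟨y, rfl⟩ := BalancedTensor.map_surjective hp z
      rw [canonicalMap_map] at hz
      -- An element of `Ker φ_{M,N}`, lifted to `M* ⊗ F₀`, is a map `M → F₀` killed by `p`, hence a
      -- map into `Z`.
      have h (x : M) : canonicalMap R M F₀ y x ∈ LinearMap.range i :=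
        (hip _).1 (LinearMap.congr_fun hz x)
      refine ⟨(LinearEquiv.ofInjective i hi).symm.toLinearMap ∘ₗ
        (canonicalMap R M F₀ y).codRestrict (LinearMap.range i) h, ?_⟩
      rw [hψ]
      congr 1
      rw [e.symm_apply_eq]
      ext x
      simp [e]
  exact ⟨(QuotientAddGroup.quotientAddEquivOfEq hker).trans
    ((QuotientAddGroup.quotientKerEquivRange ψ).trans (AddEquiv.addSubgroupCongr hrange))⟩

end

/-- For an exact complex `X₁ → X₂ → X₃` of finitely generated projective modules, the homology
of `M* ⊗_R X₁ → M* ⊗_R X₂ → M* ⊗_R X₃` is the group of stable maps from `M` to the image of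
`X₁ → X₂`. -/
lemma nonempty_homology_addEquiv_stableHom (M : Type u) [AddCommGroup M] [Module R M]
    (S : ShortComplex (ModuleCat.{u} R)) (hS : S.Exact)
    [Module.Finite R S.X₁] [Module.Projective R S.X₁] [Module.Finite R S.X₂]
    [Module.Projective R S.X₂] [Module.Finite R S.X₃] [Module.Projective R S.X₃] :
    Nonempty ((S.map (tensorFunctor R (M →ₗ[R] R))).homology ≃+
      StableHom R M (LinearMap.range S.f.hom)) := by
  let T := S.map (tensorFunctor R (M →ₗ[R] R))
  let c := canonicalMap R M S.X₂
  have hex (x : S.X₂) : S.g.hom x = 0 ↔ x ∈ LinearMap.range S.f.hom :=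
    (ShortComplex.ShortExact.moduleCat_exact_iff_function_exact S).1 hS x
  have h₁ (z : T.g.hom.ker) (x : M) : c z.1 x ∈ LinearMap.range S.f.hom := by
    rw [← hex]
    have h : canonicalMap R M S.X₃ (BalancedTensor.map R _ S.g.hom z.1) = 0 :=
      (congr_arg _ z.2).trans (map_zero _)
    exact LinearMap.congr_fun ((canonicalMap_map S.g.hom z.1).symm.trans h) x
  -- A cycle is a map `M → S.X₂` killed by `S.g`, that is, by exactness, a map into the image of
  -- `S.f`.
  let ψ : T.g.hom.ker →+ StableHom R M (LinearMap.range S.f.hom) :=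
    (QuotientAddGroup.mk' _).comp (AddMonoidHom.mk'
      (fun z => (c z.1).codRestrict (LinearMap.range S.f.hom) (h₁ z)) (by
        intro z z'
        ext x
        exact LinearMap.congr_fun (map_add c z.1 z'.1) x))
  have hsurj : Function.Surjective ψ := by
    intro f
    obtain ⟨f, rfl⟩ := QuotientAddGroup.mk_surjective f
    obtain ⟨z, hz⟩ := (canonicalMap_bijective M S.X₂).2 ((Submodule.subtype _).comp f)
    refine ⟨⟨z, (canonicalMap_bijective M S.X₃).1 ?_⟩, ?_⟩
    · refine (canonicalMap_map _ _).trans (Eq.trans ?_ (map_zero _).symm)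
      rw [hz]
      ext x
      exact (hex _).2 (f x).2
    · refine congr_arg (QuotientAddGroup.mk' (factorsThroughProj R M _)) ?_
      ext x
      exact LinearMap.congr_fun hz x
  -- Boundaries are the maps that lift to `S.X₁`, a projective cover of the image in the sense of a
  -- surjection, so they are exactly the stably trivial ones.
  have hker : T.abToCycles.range = ψ.ker := by
    ext z
    rw [AddMonoidHom.mem_ker]
    refine Iff.trans ?_ (QuotientAddGroup.eq_zero_iff _).symm
    rw [mem_factorsThroughProj_iff M (LinearMap.surjective_rangeRestrict S.f.hom)]
    constructor
    · rintro ⟨x, rfl⟩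
      refine ⟨canonicalMap R M S.X₁ x, ?_⟩
      ext y
      exact LinearMap.congr_fun (canonicalMap_map S.f.hom x).symm y
    · rintro ⟨g, hg⟩
      obtain ⟨x, rfl⟩ := (canonicalMap_bijective M S.X₁).2 g
      refine ⟨x, Subtype.ext ((canonicalMap_bijective M S.X₂).1 ?_)⟩
      refine (canonicalMap_map S.f.hom x).trans ?_
      ext y
      exact congr_arg Subtype.val (LinearMap.congr_fun hg y)
  exact ⟨T.abHomologyIso.addCommGroupIsoToAddEquiv.trans
    ((QuotientAddGroup.quotientAddEquivOfEq hker).trans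
      (QuotientAddGroup.quotientKerEquivOfSurjective ψ hsurj))⟩

end

/-! ### Negative shifts: syzygies and `Tor` -/

section

variable {R : Type u} [Ring R]

/-- Over a left coherent ring, submodules of finitely generated projective modules which are
quotients of finitely generated projective modules are finitely presented. -/
lemma IsLeftCoherent.finitePresentation_range [IsLeftCoherent R] {P Q : Type u}
    [AddCommGroup P] [Module R P] [AddCommGroup Q] [Module R Q] [Module.Finite R P]
    [Module.Projective R P] [Module.Finite R Q] [Module.Projective R Q] (f : P →ₗ[R] Q) :
    Module.FinitePresentation R (LinearMap.range f) := by
  have h := IsLeftCoherent.finite_ker f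
  have := Module.finitePresentation_of_projective R P
  refine Module.finitePresentation_of_surjective f.rangeRestrict f.surjective_rangeRestrict ?_
  rw [LinearMap.ker_rangeRestrict]
  exact Module.Finite.iff_fg.1 h

namespace FGProjectiveResolution

variable {M N : ModuleCat.{u} R} (Q : FGProjectiveResolution N)

instance (n : ℕ) : Module.Finite R (Q.complex.X n) := Q.finite n

instance (n : ℕ) : Module.Projective R (Q.complex.X n) :=
  (IsProjective.iff_projective _).2 (Q.projective n)

/-- The image of the `n`-th differential of the resolution, that is, the `n + 1`-st syzygy. -/
abbrev syzygy (n : ℕ) : ModuleCat.{u} R :=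
  ModuleCat.of R (LinearMap.range (Q.complex.d (n + 1) n).hom)

instance [IsLeftCoherent R] (n : ℕ) : Module.FinitePresentation R (Q.syzygy n) :=
  IsLeftCoherent.finitePresentation_range _

lemma surjective_π : Function.Surjective (Q.π.f 0).hom :=
  (ModuleCat.epi_iff_surjective _).1 inferInstance

lemma exact_d_π : Function.Exact (Q.complex.d 1 0).hom (Q.π.f 0).hom :=
  (ShortComplex.ShortExact.moduleCat_exact_iff_function_exact _).1 Q.exact₀

lemma exact_d_d (n : ℕ) :
    (ShortComplex.mk (Q.complex.d (n + 2) (n + 1)) (Q.complex.d (n + 1) n)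
      (Q.complex.d_comp_d _ _ _)).Exact :=
  Q.exact_succ n

lemma exact_subtype_π :
    Function.Exact (LinearMap.range (Q.complex.d 1 0).hom).subtype (Q.π.f 0).hom := by
  intro x
  rw [Q.exact_d_π x]
  simp

/-- The exact sequence `0 → Ω N → Q₀ → N → 0`. -/
noncomputable abbrev syzygyZeroShortComplex : ShortComplex (ModuleCat.{u} R) :=
  ShortComplex.mk (X₁ := Q.syzygy 0) (X₂ := Q.complex.X 0) (X₃ := N)
    (ModuleCat.ofHom (Submodule.subtype _)) (Q.π.f 0) (by
      ext x
      exact Q.exact_subtype_π.apply_apply_eq_zero x)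

lemma syzygyZeroShortComplex_shortExact : Q.syzygyZeroShortComplex.ShortExact where
  exact := (ShortComplex.ShortExact.moduleCat_exact_iff_function_exact _).2 Q.exact_subtype_π
  mono_f := (ModuleCat.mono_iff_injective _).2 (Submodule.injective_subtype _)
  epi_g := (ModuleCat.epi_iff_surjective _).2 Q.surjective_π

/-- The exact sequence `0 → Ωⁿ⁺² N → Qₙ₊₁ → Ωⁿ⁺¹ N → 0`. -/
noncomputable abbrev syzygySuccShortComplex (n : ℕ) : ShortComplex (ModuleCat.{u} R) :=
  ShortComplex.mk (X₁ := Q.syzygy (n + 1)) (X₂ := Q.complex.X (n + 1)) (X₃ := Q.syzygy n)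
    (ModuleCat.ofHom (Submodule.subtype _))
    (ModuleCat.ofHom (Q.complex.d (n + 1) n).hom.rangeRestrict) (by
      ext ⟨_, x, rfl⟩
      exact congr_arg (fun f => f.hom x) (Q.complex.d_comp_d (n + 2) (n + 1) n))

lemma syzygySuccShortComplex_shortExact (n : ℕ) : (Q.syzygySuccShortComplex n).ShortExact where
  exact := (ShortComplex.ShortExact.moduleCat_exact_iff_function_exact _).2 (by
    intro x
    have h := (ShortComplex.ShortExact.moduleCat_exact_iff_function_exact _).1 (Q.exact_d_d n) x
    refine Iff.trans ?_ (h.trans ?_)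
    · exact Subtype.ext_iff
    · simp)
  mono_f := (ModuleCat.mono_iff_injective _).2 (Submodule.injective_subtype _)
  epi_g := (ModuleCat.epi_iff_surjective _).2 (LinearMap.surjective_rangeRestrict _)

/-- Each syzygy raises the shift by one. Coherence supplies resolutions of the intermediate
syzygies. -/
lemma nonempty_shift_addEquiv_syzygy [IsLeftCoherent R] (X : SingularityCategory R) (k : ℕ) :
    ∀ (Z : FGProjectiveResolution (Q.syzygy k)) (n m : ℤ) (_ : n + k + 1 = m),
      Nonempty ((X ⟶ Q.singObj⟦n⟧) ≃+ (X ⟶ Z.singObj⟦m⟧)) := by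
  induction k with
  | zero =>
    intro Z n m h
    exact nonempty_shift_addEquiv_of_shortExact Q.syzygyZeroShortComplex_shortExact Z Q X n m
      (by simpa using h)
  | succ k ih =>
    intro Z n m h
    obtain ⟨Z'⟩ := FGProjectiveResolution.nonempty (Q.syzygy k)
    obtain ⟨e⟩ := ih Z' n (m - 1) (by push_cast at h; lia)
    obtain ⟨e'⟩ := nonempty_shift_addEquiv_of_shortExact (Q.syzygySuccShortComplex_shortExact k)
      Z Z' X (m - 1) m (by lia)
    exact ⟨e.trans e'⟩

/-- Morphisms to negative shifts in the singularity category are stable maps to syzygies. -/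
lemma nonempty_shift_addEquiv_stableHom [IsLeftCoherent R] (hM : leftPerp R M)
    (P : FGProjectiveResolution M) (k : ℕ) (n : ℤ) (hn : n + k + 1 = 0) :
    Nonempty ((P.singObj ⟶ Q.singObj⟦n⟧) ≃+ StableHom R M (Q.syzygy k)) := by
  obtain ⟨Z⟩ := FGProjectiveResolution.nonempty (Q.syzygy k)
  obtain ⟨e⟩ := Q.nonempty_shift_addEquiv_syzygy P.singObj k Z n 0 hn
  exact ⟨e.trans ((((shiftFunctorZero (SingularityCategory R) ℤ).app Z.singObj).postcompAddEquiv
    P.singObj).trans (stableHomEquiv hM P Z).symm)⟩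

/-- `Tor` of the dual of `M` as stable maps from `M` to syzygies. -/
lemma nonempty_torGroup_addEquiv_stableHom (M : ModuleCat.{u} R) (k : ℕ) :
    Nonempty (TorGroup R (M →ₗ[R] R) N (k + 1) ≃+ StableHom R M (Q.syzygy (k + 1))) := by
  -- `Tor` in degree `k + 1` is the homology at `Q.complex.X (k + 1)`; the incoming differential
  -- there has image `Q.syzygy (k + 1)`, the `(k + 2)`-nd syzygy.
  obtain ⟨e⟩ := nonempty_homology_addEquiv_stableHom M _ (Q.exact_d_d k)
  let K := ((tensorFunctor R (M →ₗ[R] R)).mapHomologicalComplex (ComplexShape.down ℕ)).obj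
    Q.complex
  let i : TorGroup R (M →ₗ[R] R) N (k + 1) ≅ (K.sc' (k + 2) (k + 1) k).homology :=
    Q.toProjectiveResolution.isoLeftDerivedObj (tensorFunctor R (M →ₗ[R] R)) (k + 1) ≪≫
      ShortComplex.homologyMapIso (K.isoSc' (k + 2) (k + 1) k (by simp) (by simp))
  exact ⟨i.addCommGroupIsoToAddEquiv.trans e⟩

end FGProjectiveResolution

end

theorem proposition4p7 (R : Type u) [Ring R] [IsLeftCoherent R] (M N : ModuleCat.{u} R)
    (hM : leftPerp R M) [Module.FinitePresentation R N]
    (P : FGProjectiveResolution M) (Q : FGProjectiveResolution N) :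
    (∀ n : ℤ, n ≤ -2 →
      Nonempty ((P.singObj ⟶ Q.singObj⟦n⟧) ≃+ TorGroup R (M →ₗ[R] R) N (-(n + 1)).toNat)) ∧
    Nonempty ((P.singObj ⟶ Q.singObj⟦(-1 : ℤ)⟧) ≃+ (canonicalMap R M N).ker) ∧
    Nonempty ((P.singObj ⟶ Q.singObj) ≃+ StableHom R M N) ∧
    (∀ n : ℤ, 1 ≤ n →
      Nonempty ((P.singObj ⟶ Q.singObj⟦n⟧) ≃+ Abelian.Ext M N n.toNat)) := by
  refine ⟨fun n hn => ?_, ?_, ⟨(FGProjectiveResolution.stableHomEquiv hM P Q).symm⟩,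
    fun n hn => ?_⟩
  · obtain ⟨k, hk⟩ : ∃ k : ℕ, (-(n + 1)).toNat = k + 1 := ⟨(-(n + 1)).toNat - 1, by lia⟩
    rw [hk]
    obtain ⟨e⟩ := Q.nonempty_shift_addEquiv_stableHom hM P (k + 1) n (by lia)
    obtain ⟨e'⟩ := Q.nonempty_torGroup_addEquiv_stableHom M k
    exact ⟨e.trans e'.symm⟩
  · obtain ⟨e⟩ := Q.nonempty_shift_addEquiv_stableHom hM P 0 (-1) (by simp)
    obtain ⟨e'⟩ := nonempty_stableHom_addEquiv_ker M (Submodule.injective_subtype _)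
      Q.exact_subtype_π Q.surjective_π (LinearMap.surjective_rangeRestrict (Q.complex.d 1 0).hom)
    exact ⟨e.trans e'⟩
  · obtain ⟨k, rfl⟩ := Int.eq_ofNat_of_zero_le (show 0 ≤ n by lia)
    exact P.nonempty_addEquiv_ext hM Q k (by lia)
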